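/- **Setting.** Let $F(t^1,\dots,t^n)$ ($n\ge 1$) be a holomorphic function on an open set $U\subset\mathbb C^n$ that solves the quasihomogeneous WDVV equations with constants $\eta_{\alpha\beta},q_\alpha,r_\alpha,d,A_{\alpha\beta},B_\alpha,C\in\mathbb C$ ($\eta$, $A$ symmetric, $\eta$ nondegenerate, $(\eta^{\alpha\beta})=(\eta_{\alpha\beta})^{-1}$, summation over repeated Greek indices, $\partial_\alpha=\partial/\partial t^\alpha$): $\partial_\alpha\partial_\beta\partial_\lambda F\,\eta^{\lambda\mu}\,\partial_\mu\partial_\gamma\partial_\delta F$ is symmetric in $\alpha,\delta$; $\partial_1\partial_\alpha\partial_\beta F=\eta_{\alpha\beta}$; and $E^\alpha\partial_\alpha F=(3-d)F+\frac12A_{\alpha\beta}t^\alpha t^\beta+B_\alpha t^\alpha+C$ with $E^\alpha=(1-q_\alpha)t^\alpha+r_\alpha$. The constants satisfy $q_1=0$; $r_\alpha\ne0$ only if $q_\alpha=1$; $A_{\alpha\beta}\neq0$ only if $q_\alpha+q_\beta=d-1$; $B_\alpha\ne0$ only if $q_\alpha=d-2$; $C\ne0$ only if $d=3$; $A_{1\alpha}=\eta_{\alpha\varepsilon}r_\varepsilon$;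 $B_1=0$. The flat coordinates are normalized by $\eta_{\alpha\beta}=\delta_{\alpha+\beta,n+1}$. Put $\mu_\alpha=q_\alpha-\frac d2$. Upper indices are raised with $\eta^{\alpha\beta}$ and $c$ with indices denotes derivatives of $F$, e.g. $c^\gamma_{\alpha\beta}=\eta^{\gamma\gamma'}\partial_{\gamma'}\partial_\alpha\partial_\beta F$, $c^{\alpha\beta}_{\gamma\mu}=\eta^{\alpha\alpha'}\eta^{\beta\beta'}\partial_{\alpha'}\partial_{\beta'}\partial_\gamma\partial_\mu F$. Assume semisimplicity: for $t$ in a dense subset of $U$ the algebra $\partial_\alpha\cdot\partial_\beta=c^\gamma_{\alpha\beta}(t)\partial_\gamma$ is semisimple. **G-function.** Near points of semisimplicity let $u_1,\dots,u_n$ be canonical coordinates, $\frac{\partial}{\partial u_i}\cdot\frac{\partial}{\partial u_j}=\delta_{ij}\frac{\partial}{\partial u_i}$, normalized by $E=\sum u_i\frac{\partial}{\partial u_i}$. Put $t_\alpha=\eta_{\alpha\beta}t^\beta$, $\eta_{ii}=\langle\frac{\partial}{\partial u_i},\frac{\partial}{\partial u_i}\rangle$, $\psi_{i\alpha}=\eta_{ii}^{-1/2}\,\partial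 t_\alpha/\partial u_i$, $\psi_i^\alpha=\eta^{\alpha\beta}\psi_{i\beta}$, $V_{ij}=\sum_\alpha\mu_\alpha\psi_{i\alpha}\psi_j^\alpha$. Let $\tau_I$ be given by $d\log\tau_I=\sum_iH_i\,du_i$, $H_i=\frac12\sum_{j\ne i}\frac{V_{ij}^2}{u_i-u_j}$, and $J=\det(\partial t^\alpha/\partial u_i)$. The G-function is $G=\log\left(\tau_I/J^{1/24}\right)$; it is assumed to be given as a holomorphic function $G$ on $U$ that has this form near the points of semisimplicity. **Genus zero bracket.** For smooth curves in $U$ let $$\{v^\alpha(X),v^\beta(Y)\}_2^{(0)}=g^{\alpha\beta}(v(X))\,\delta'(X-Y)+\Gamma^{\alpha\beta}_\gamma(v(X))\,v^\gamma_X\,\delta(X-Y),$$ where $g^{\alpha\beta}=E^\varepsilon c_\varepsilon^{\alpha\beta}$ and $\Gamma^{\alpha\beta}_\gamma=\left(\frac{1+d}2-q_\beta\right)c^{\alpha\beta}_\gamma$. **Deformed bracket.** The one-loop deformed second bracket is the image of $\{\ ,\ \}_2^{(0)}$, modulo $O(\varepsilon^4)$, under the transform $$t^\alpha=v^\alpha+\varepsilon^2w^\alpha,\qquad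 w_\alpha=\partial_X\,\partial_{T^{\alpha,0}}\left[\tfrac1{24}\log\det\left(c_{\alpha\beta\gamma}(v)v_X^\gamma\right)+G(v)\right],\qquad \frac{\partial v^\gamma}{\partial T^{\alpha,0}}=c^\gamma_{\alpha\beta}(v)v_X^\beta,$$ on curves with $\det(c_{\alpha\beta\gamma}(v)v_X^\gamma)\neq0$. Explicitly it is the bracket $\{\ ,\ \}_2=\{\ ,\ \}'_2+\varepsilon^2\{\ ,\ \}''_2$, defined for all smooth curves in $U$ (coefficients at $t(X)$), with $$\begin{aligned}\{t^\alpha(X),t^\beta(Y)\}'_2&=\{t^\alpha(X),t^\beta(Y)\}_2^{(0)}+\varepsilon^2\big[h^{\alpha\beta}\delta'''+r^{\alpha\beta}_\gamma t^\gamma_X\delta''+(f^{\alpha\beta}_\gamma t^\gamma_{XX}+q^{\alpha\beta}_{\gamma\mu}t^\gamma_Xt^\mu_X)\delta'\\&\quad+(b^{\alpha\beta}_{\gamma\mu}t^\gamma_Xt^\mu_{XX}+a^{\alpha\beta}_{\gamma\mu\nu}t^\gamma_Xt^\mu_Xt^\nu_X+p^{\alpha\beta}_\gamma t^\gamma_{XXX})\delta\big],\\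 \{t^\alpha(X),t^\beta(Y)\}''_2&=a^{\alpha\beta}\delta'''+b^{\alpha\beta}\delta''+e^{\alpha\beta}\delta'+(\partial_Xq^{\alpha\beta})\delta .\end{aligned}$$ Here, with $w^\alpha_{\beta\gamma}=c^{\mu\nu}_{\mu\beta}c^\alpha_{\nu\gamma}-c^{\mu\nu}_\gamma c^\alpha_{\mu\nu\beta}$, $$\begin{aligned} h^{\alpha\beta}&=\tfrac1{12}\left(\partial_\nu(g^{\mu\nu}c^{\alpha\beta}_\mu)+\tfrac12c^{\mu\nu}_\nu c^{\alpha\beta}_\mu\right),\qquad p^{\alpha\beta}_\gamma=\tfrac1{12}(\tfrac12-\mu_\beta)c^{\alpha\beta}_{\mu\nu}c^{\mu\nu}_\gamma,\\ a^{\alpha\beta}_{\gamma\mu\nu}&=\tfrac1{72}(\tfrac12-\mu_\beta)\big[\eta^{\alpha\sigma}(\partial_\sigma\partial_\nu w^\beta_{\gamma\mu}+\partial_\sigma\partial_\gamma w^\beta_{\mu\nu}+\partial_\sigma\partial_\mu w^\beta_{\gamma\nu}-2\partial_\mu\partial_\nu w^\beta_{\gamma\sigma}-2\partial_\mu\partial_\gamma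 w^\beta_{\nu\sigma}-2\partial_\nu\partial_\gamma w^\beta_{\mu\sigma})\\ &\quad+\eta^{\xi\zeta}(6c^{\alpha\sigma}_{\xi\zeta}c^\beta_{\sigma\gamma\mu\nu}+3c^{\alpha\sigma}_{\xi\zeta\gamma}c^\beta_{\sigma\mu\nu}+3c^{\alpha\sigma}_{\xi\zeta\mu}c^\beta_{\sigma\gamma\nu}+3c^{\alpha\sigma}_{\xi\zeta\nu}c^\beta_{\sigma\gamma\mu}+c^{\alpha\sigma}_{\xi\zeta\gamma\mu}c^\beta_{\sigma\nu}+c^{\alpha\sigma}_{\xi\zeta\gamma\nu}c^\beta_{\sigma\mu}+c^{\alpha\sigma}_{\xi\zeta\mu\nu}c^\beta_{\sigma\gamma})\big],\\ b^{\alpha\beta}_{\gamma\mu}&=\tfrac1{12}(\tfrac12-\mu_\beta)\big[\eta^{\alpha\sigma}(-2\partial_\gamma w^\beta_{\mu\sigma}+\partial_\sigma w^\beta_{\gamma\mu}-\partial_\mu w^\beta_{\gamma\sigma})+\eta^{\xi\zeta}(3c^{\alpha\sigma}_{\xi\zeta}c^\beta_{\sigma\gamma\mu}+\tfrac32c^{\alpha\sigma}_{\xi\zeta\gamma}c^\beta_{\sigma\mu}+\tfrac12c^{\alpha\sigma}_{\xi\zeta\mu}c^\beta_{\sigma\gamma})\big],\\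 r^{\alpha\beta}_\gamma&=\tfrac32\partial_\gamma h^{\alpha\beta}+\tfrac1{24}(\tfrac32-\mu_\beta)c^{\alpha\nu}_\gamma c^{\beta\mu}_{\nu\mu}-\tfrac1{24}(\tfrac32-\mu_\alpha)c^{\beta\nu}_\gamma c^{\alpha\mu}_{\nu\mu},\qquad f^{\alpha\beta}_\gamma=r^{\alpha\beta}_\gamma+p^{\alpha\beta}_\gamma+p^{\beta\alpha}_\gamma-\partial_\gamma h^{\alpha\beta},\\ q^{\alpha\beta}_{\gamma\mu}&=\tfrac12(b^{\alpha\beta}_{\mu\gamma}+b^{\beta\alpha}_{\mu\gamma})+\tfrac12\partial_\gamma r^{\alpha\beta}_\mu+\tfrac12\partial_\mu r^{\alpha\beta}_\gamma-\partial_\mu\partial_\gamma h^{\alpha\beta}-\tfrac12\partial_\mu(p^{\alpha\beta}_\gamma+p^{\beta\alpha}_\gamma), \end{aligned}$$ and $$\begin{aligned} a^{\alpha\beta}&=2c^{\alpha\mu}_\gamma g^{\gamma\beta}\partial_\mu G,\\ b^{\alpha\beta}&=\tfrac32\partial_Xa^{\alpha\beta}+(c^{\alpha\rho}_\mu g^{\gamma\beta}-c^{\beta\rho}_\mu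 g^{\gamma\alpha})\,\partial_\gamma\partial_\rho G\,t^\mu_X+(\mu_\alpha-\mu_\beta)c^{\alpha\rho}_\gamma c^{\gamma\beta}_\mu\,\partial_\rho G\,t^\mu_X,\\ q^{\alpha\beta}&=(\tfrac12-\mu_\beta)\left(\partial_\sigma\partial_\rho G\,c^{\alpha\sigma}_\mu c^{\beta\rho}_\nu-\partial_\sigma\partial_\nu G\,c^{\beta\sigma}_\rho c^{\rho\alpha}_\mu+\partial_\sigma G\,c^{\alpha\beta}_{\rho\mu}c^{\rho\sigma}_\nu\right)t^\mu_Xt^\nu_X,\\ e^{\alpha\beta}&=q^{\alpha\beta}+q^{\beta\alpha}+\partial_Xb^{\alpha\beta}-\partial_X^2a^{\alpha\beta}. \end{aligned}$$ **Statement.** If $d\ne1$, then the field $T(X)=\frac{2}{1-d}\,t^n(X)$ has the Virasoro bracket $$\{T(X),T(Y)\}_2=[T(X)+T(Y)]\,\delta'(X-Y)+\varepsilon^2\,\frac c{12}\,\delta'''(X-Y),\qquad c\,\varepsilon^2=\frac{12\,\varepsilon^2}{(1-d)^2}\left[\frac n2-2\sum_{\alpha=1}^n\mu_\alpha^2\right].$$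 This holds for the explicit bracket $\{\ ,\ \}_2$ above (with terms up to $\varepsilon^2$) exactly, on all smooth curves in $U$; and for the image of $\{\ ,\ \}_2^{(0)}$ under $t=v+\varepsilon^2w$, that is, for $T=\frac2{1-d}(v^n+\varepsilon^2w^n)$ and the bracket $\{\ ,\ \}_2^{(0)}$, it holds modulo $O(\varepsilon^4)$, on all smooth curves $v$ in $U$ with $\det(c_{\alpha\beta\gamma}(v)v^\gamma_X)\ne0$. -/

import Mathlib

open scoped Topology ContDiff

noncomputable section

namespace OneLoop

/-! ## Partial derivatives -/

/-- The partial derivative `∂f/∂t^α` of a function on `ℂⁿ`. -/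
def pd {n : ℕ} (α : Fin n) (f : (Fin n → ℂ) → ℂ) (t : Fin n → ℂ) : ℂ :=
  fderiv ℂ f t (Pi.single α 1)

/-- The iterated partial derivative `∂_{α₁} ∂_{α₂} ⋯ f` for a list `[α₁, α₂, …]`. -/
def pds {n : ℕ} : List (Fin n) → ((Fin n → ℂ) → ℂ) → (Fin n → ℂ) → ℂ
  | [], f => f
  | α :: l, f => pd α (pds l f)

/-! ## Solutions of the WDVV equations (Frobenius manifolds in flat coordinates) -/

/-- A quasihomogeneous solution `F` of the WDVV equations of associativity on an open set `U`
of `ℂⁿ`. The index `1` of the unit vector field is `0 : Fin n`. The matrix `η` is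
`(η_{αβ})`, its inverse `η⁻¹` is `(η^{αβ})`. -/
structure WDVVSolution (n : ℕ) [NeZero n] where
  U : Set (Fin n → ℂ)
  F : (Fin n → ℂ) → ℂ
  η : Matrix (Fin n) (Fin n) ℂ
  q : Fin n → ℂ
  r : Fin n → ℂ
  d : ℂ
  A : Matrix (Fin n) (Fin n) ℂ
  B : Fin n → ℂ
  C : ℂ
  isOpen_U : IsOpen U
  analytic_F : AnalyticOnNhd ℂ F U
  η_symm : η.IsSymm
  η_nondeg : IsUnit η.det
  /-- associativity -/
  assoc : ∀ t ∈ U, ∀ α β γ δ : Fin n,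
    ∑ l, ∑ m, pds [α, β, l] F t * η⁻¹ l m * pds [m, γ, δ] F t =
      ∑ l, ∑ m, pds [δ, β, l] F t * η⁻¹ l m * pds [m, γ, α] F t
  /-- `∂_1` is the unit, and `η` is the metric -/
  unit : ∀ t ∈ U, ∀ α β : Fin n, pds [0, α, β] F t = η α β
  /-- quasihomogeneity -/
  quasihom : ∀ t ∈ U,
    ∑ α, ((1 - q α) * t α + r α) * pd α F t =
      (3 - d) * F t + (1 / 2) * ∑ α, ∑ β, A α β * t α * t β + ∑ α, B α * t α + C
  /- normalization of the constants -/
  q_zero : q 0 = 0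
  r_normal : ∀ α, r α ≠ 0 → q α = 1
  A_symm : A.IsSymm
  A_normal : ∀ α β, A α β ≠ 0 → q α + q β = d - 1
  B_normal : ∀ α, B α ≠ 0 → q α = d - 2
  C_normal : C ≠ 0 → d = 3
  A_zero : ∀ α, A 0 α = ∑ ε, η α ε * r ε
  B_zero : B 0 = 0

namespace WDVVSolution

variable {n : ℕ} [NeZero n] (S : WDVVSolution n)

/-- The last index `n`. -/
def last (_S : WDVVSolution n) : Fin n := Fin.rev 0

/-- `c^α_{β₁ β₂ …} = η^{αα'} ∂_{α'} ∂_{β₁} ∂_{β₂} ⋯ F`. -/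
def c1 (α : Fin n) (l : List (Fin n)) (t : Fin n → ℂ) : ℂ :=
  ∑ α', S.η⁻¹ α α' * pds (α' :: l) S.F t

/-- `c^{αβ}_{γ₁ γ₂ …} = η^{αα'} η^{ββ'} ∂_{α'} ∂_{β'} ∂_{γ₁} ∂_{γ₂} ⋯ F`. -/
def c2 (α β : Fin n) (l : List (Fin n)) (t : Fin n → ℂ) : ℂ :=
  ∑ α', ∑ β', S.η⁻¹ α α' * S.η⁻¹ β β' * pds (α' :: β' :: l) S.F t

/-- The components of the Euler vector field. -/
def E (ε : Fin n) (t : Fin n → ℂ) : ℂ := (1 - S.q ε) * t ε + S.r ε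

/-- `μ_α = q_α - d/2`. -/
def μ (α : Fin n) : ℂ := S.q α - S.d / 2

/-- The intersection form `g^{αβ} = E^ε c^{αβ}_ε`. -/
def g (α β : Fin n) (t : Fin n → ℂ) : ℂ := ∑ ε, S.E ε t * S.c2 α β [ε] t

/-- The contravariant Christoffel coefficients `Γ^{αβ}_γ = ((1+d)/2 - q_β) c^{αβ}_γ` of the
intersection form. -/
def Γ (α β γ : Fin n) (t : Fin n → ℂ) : ℂ := ((1 + S.d) / 2 - S.q β) * S.c2 α β [γ] t

/-! ## Semisimplicity, canonical coordinates, the isomonodromic tau function, the G-function -/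

/-- The product `a · b` of two tangent vectors at `t`. -/
def mul (t a b : Fin n → ℂ) : Fin n → ℂ := fun γ => ∑ α, ∑ β, S.c1 γ [α, β] t * a α * b β

/-- The commutative algebra `A_t` is semisimple, i.e. (over `ℂ`) it has a basis of pairwise
orthogonal idempotents. -/
def IsSemisimpleAt (t : Fin n → ℂ) : Prop :=
  ∃ e : Fin n → Fin n → ℂ, LinearIndependent ℂ e ∧
    ∀ i j, S.mul t (e i) (e j) = if i = j then e i else 0

/-- The Frobenius manifold is semisimple: `A_t` is semisimple for generic `t`. -/
def IsSemisimple : Prop := S.U ⊆ closure {t ∈ S.U | S.IsSemisimpleAt t}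

/-- The Jacobi matrix `(∂t^α/∂u_i)`, the inverse of `(∂u_i/∂t^α)`. -/
def dtdu (_S : WDVVSolution n) (u : (Fin n → ℂ) → Fin n → ℂ) (t : Fin n → ℂ) :
    Matrix (Fin n) (Fin n) ℂ :=
  (Matrix.of fun i α => pd α (fun s => u s i) t)⁻¹

/-- The derivative `∂f/∂u_i`. -/
def pdu (u : (Fin n → ℂ) → Fin n → ℂ) (i : Fin n) (f : (Fin n → ℂ) → ℂ) (t : Fin n → ℂ) : ℂ :=
  ∑ α, S.dtdu u t α i * pd α f t

/-- `u` is a system of canonical coordinates on `V`: `∂/∂u_i · ∂/∂u_j = δ_{ij} ∂/∂u_i`. They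
are normalized by `E = ∑ u_i ∂/∂u_i`, so that `u_1, …, u_n` are the eigenvalues of the
multiplication by `E`, that is, the roots of `det(g^{αβ} - u η^{αβ}) = 0`. -/
structure IsCanonical (V : Set (Fin n → ℂ)) (u : (Fin n → ℂ) → Fin n → ℂ) : Prop where
  analytic : ∀ i, AnalyticOnNhd ℂ (fun t => u t i) V
  injOn : Set.InjOn u V
  jacobian : ∀ t ∈ V, (Matrix.of fun i α => pd α (fun s => u s i) t).det ≠ 0
  mul_eq : ∀ t ∈ V, ∀ i j : Fin n,
    S.mul t (fun α => S.dtdu u t α i) (fun α => S.dtdu u t α j) =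
      if i = j then (fun α => S.dtdu u t α i) else 0
  euler : ∀ t ∈ V, ∀ i, ∑ ε, S.E ε t * pd ε (fun s => u s i) t = u t i

/-- `η_{ii} = <∂/∂u_i, ∂/∂u_i>`. -/
def ηdiag (u : (Fin n → ℂ) → Fin n → ℂ) (t : Fin n → ℂ) (i : Fin n) : ℂ :=
  ∑ α, ∑ β, S.η α β * S.dtdu u t α i * S.dtdu u t β i

/-- `ψ_{iα} = (∂t_α/∂u_i) / √η_{ii}`, where `t_α = η_{αβ} t^β`. The choice of the square root
does not matter below: only the squares `V_{ij}²` are used. -/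
def ψ (u : (Fin n → ℂ) → Fin n → ℂ) (t : Fin n → ℂ) (i α : Fin n) : ℂ :=
  (∑ β, S.η α β * S.dtdu u t β i) / (S.ηdiag u t i) ^ (1 / 2 : ℂ)

/-- `V_{ij} = ∑_α μ_α ψ_{iα} ψ_j^α` with `ψ_j^α = η^{αβ} ψ_{jβ}`. -/
def V (u : (Fin n → ℂ) → Fin n → ℂ) (t : Fin n → ℂ) (i j : Fin n) : ℂ :=
  ∑ α, S.μ α * S.ψ u t i α * ∑ β, S.η⁻¹ α β * S.ψ u t j β

/-- The isomonodromic Hamiltonians `H_i = ½ ∑_{j ≠ i} V_{ij}² / (u_i - u_j)`. (Where `u_i = u_j`,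
the function `V_{ij}² / (u_i - u_j)` has a removable singularity with value `0`, since `V_{ij}` is
divisible by `u_i - u_j`.) -/
def H (u : (Fin n → ℂ) → Fin n → ℂ) (i : Fin n) (t : Fin n → ℂ) : ℂ :=
  (1 / 2) * ∑ j ∈ Finset.univ.erase i, S.V u t i j ^ 2 / (u t i - u t j)

/-- `τ` is an isomonodromic tau function on `V`: `d log τ = ∑ H_i du_i`. -/
structure IsTau (V : Set (Fin n → ℂ)) (u : (Fin n → ℂ) → Fin n → ℂ)
    (τ : (Fin n → ℂ) → ℂ) : Prop where
  analytic : AnalyticOnNhd ℂ τ V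
  ne_zero : ∀ t ∈ V, τ t ≠ 0
  dlog : ∀ t ∈ V, ∀ i, S.pdu u i τ t = S.H u i t * τ t

/-- `G` is the G-function of the Frobenius manifold: an analytic function which, near the points
of semisimplicity, is `G = log (τ_I / J^{1/24})` with `J = det(∂t^α/∂u_i)`, for some choice of
canonical coordinates, of the tau function (unique up to a constant factor) and of the branches. -/
structure IsGFunction (G : (Fin n → ℂ) → ℂ) : Prop where
  analytic : AnalyticOnNhd ℂ G S.U
  formula : ∀ t ∈ S.U, S.IsSemisimpleAt t → ∃ W : Set (Fin n → ℂ), IsOpen W ∧ t ∈ W ∧ W ⊆ S.U ∧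
    ∃ (u : (Fin n → ℂ) → Fin n → ℂ) (τ : (Fin n → ℂ) → ℂ), S.IsCanonical W u ∧ S.IsTau W u τ ∧
      ∀ s ∈ W, Complex.exp (G s) ^ 24 * (S.dtdu u s).det = τ s ^ 24

end WDVVSolution

/-! ## Distributions supported on the diagonal

A distribution `K(X,Y)` of the form `∑ f_k(X) δ^{(k)}(X-Y)` is represented by the operator
`ψ ↦ ∫ K(X,Y) ψ(Y) dY` that it defines on smooth functions. -/

/-- Kernels `K(X,Y)`, as operators `ψ ↦ ∫ K(X,Y) ψ(Y) dY`. -/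
abbrev LocalKernel : Type := (ℝ → ℂ) → ℝ → ℂ

namespace LocalKernel

/-- `δ^{(k)}(X-Y)`. -/
def delta (k : ℕ) : LocalKernel := fun ψ X => iteratedDeriv k ψ X

/-- `f(X) K(X,Y)`. -/
def mulX (f : ℝ → ℂ) (K : LocalKernel) : LocalKernel := fun ψ X => f X * K ψ X

/-- `f(Y) K(X,Y)`. -/
def mulY (f : ℝ → ℂ) (K : LocalKernel) : LocalKernel := fun ψ X => K (fun Y => f Y * ψ Y) X

/-- `∂K/∂X`. -/
def dX (K : LocalKernel) : LocalKernel := fun ψ X => deriv (K ψ) X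

/-- `∂K/∂Y` (integration by parts). -/
def dY (K : LocalKernel) : LocalKernel := fun ψ X => K (fun Y => -deriv ψ Y) X

/-- Equality of kernels as distributions. -/
def DistribEq (K L : LocalKernel) : Prop := ∀ ψ : ℝ → ℂ, ContDiff ℝ ∞ ψ → ∀ X, K ψ X = L ψ X

/-- `[T(X) + T(Y)] δ'(X-Y) + ε² (c/12) δ'''(X-Y)`. -/
def virasoro (T : ℝ → ℂ) (c ε : ℂ) : LocalKernel :=
  mulX T (delta 1) + mulY T (delta 1) + (ε ^ 2 * (c / 12)) • delta 3

end LocalKernel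

open LocalKernel

/-! ## Jets and local Poisson brackets -/

/-- The space of jets `(t, t_X, t_XX, …)` with `m` entries. -/
abbrev Jets (m n : ℕ) : Type := Fin m → Fin n → ℂ

/-- The jet of the curve `v` at `X`. -/
def jet {n : ℕ} (m : ℕ) (v : ℝ → Fin n → ℂ) (X : ℝ) : Jets m n :=
  fun k γ => iteratedDeriv k (fun Y => v Y γ) X

/-- The partial derivative of a function on jets with respect to the `k`-th derivative of the
`γ`-th coordinate. -/
def jpd {m n : ℕ} (k : Fin m) (γ : Fin n) (a : Jets m n → ℂ) (j : Jets m n) : ℂ :=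
  fderiv ℂ a j (Pi.single k (Pi.single γ 1))

/-- The total derivative `∂_X` of a function on jets. -/
def totalD {m n : ℕ} (a : Jets m n → ℂ) : Jets (m + 1) n → ℂ :=
  fun j => ∑ k : Fin m, ∑ γ, jpd k γ a (fun i => j i.castSucc) * j k.succ γ

/-- The bracket of two local densities `a`, `b` for the bracket `P γ δ = {v^γ(X), v^δ(Y)}`:
`{a(X), b(Y)} = ∑ ∂a/∂v^{γ,(k)}(X) ∂b/∂v^{δ,(l)}(Y) ∂_X^k ∂_Y^l {v^γ(X), v^δ(Y)}`. -/
def bracketOf {m n : ℕ} (P : Fin n → Fin n → LocalKernel) (v : ℝ → Fin n → ℂ)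
    (a b : Jets m n → ℂ) : LocalKernel :=
  ∑ γ, ∑ δ, ∑ k : Fin m, ∑ l : Fin m,
    mulX (fun X => jpd k γ a (jet m v X))
      (mulY (fun Y => jpd l δ b (jet m v Y)) (dX^[k] (dY^[l] (P γ δ))))

namespace WDVVSolution

variable {n : ℕ} [NeZero n] (S : WDVVSolution n)

/-- The genus zero second Poisson bracket
`{v^α(X), v^β(Y)} = g^{αβ}(v(X)) δ'(X-Y) + Γ^{αβ}_γ(v(X)) v^γ_X δ(X-Y)`. -/
def bracket0 (v : ℝ → Fin n → ℂ) (α β : Fin n) : LocalKernel :=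
  mulX (fun X => S.g α β (v X)) (delta 1) +
    mulX (fun X => ∑ γ, S.Γ α β γ (v X) * jet 2 v X 1 γ) (delta 0)

/-! ### The deformed second bracket: image of the genus zero one under `v ↦ t = v + ε² w` -/

/-- `det M` with `M_{αβ} = c_{αβγ}(t) t^γ_X`, at `x = t`, `y = t_X`. -/
def detM (x y : Fin n → ℂ) : ℂ :=
  (Matrix.of fun α β => ∑ γ, pds [α, β, γ] S.F x * y γ).det

/-- `∂𝓕/∂t^γ` for the genus one free energy `𝓕 = (1/24) log det M(t, t_X) + G(t)`
(independent of the branch of the logarithm). -/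
def dF1_dt (G : (Fin n → ℂ) → ℂ) (γ : Fin n) (x y : Fin n → ℂ) : ℂ :=
  (1 / 24) * (pd γ (fun x' => S.detM x' y) x / S.detM x y) + pd γ G x

/-- `∂𝓕/∂t^γ_X` for the same `𝓕`. -/
def dF1_dtX (γ : Fin n) (x y : Fin n → ℂ) : ℂ :=
  (1 / 24) * (pd γ (fun y' => S.detM x y') y / S.detM x y)

/-- The genus zero flow `∂t^γ/∂T^{α,0} = c^γ_{αβ}(t) t^β_X`. -/
def flow (α γ : Fin n) (j : Jets 2 n) : ℂ := ∑ β, S.c1 γ [α, β] (j 0) * j 1 β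

/-- `∂𝓕/∂T^{α,0}` along the genus zero flow. -/
def dF1_dT (G : (Fin n → ℂ) → ℂ) (α : Fin n) (j : Jets 3 n) : ℂ :=
  ∑ γ, (S.dF1_dt G γ (j 0) (j 1) * S.flow α γ (fun i => j i.castSucc) +
    S.dF1_dtX γ (j 0) (j 1) * totalD (S.flow α γ) j)

/-- `w_α = ∂²𝓕/∂X∂T^{α,0}`. -/
def wLow (G : (Fin n → ℂ) → ℂ) (α : Fin n) : Jets 4 n → ℂ := totalD (S.dF1_dT G α)

/-- `w^α = η^{αβ} w_β`. -/
def wUp (G : (Fin n → ℂ) → ℂ) (α : Fin n) (j : Jets 4 n) : ℂ := ∑ β, S.η⁻¹ α β * S.wLow G β j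

/-- The infinitesimal Bäcklund transform `t^α = v^α + ε² w^α(v, v_X, v_XX, v_XXX)`. -/
def backlund (G : (Fin n → ℂ) → ℂ) (ε : ℂ) (α : Fin n) (j : Jets 4 n) : ℂ :=
  j 0 α + ε ^ 2 * S.wUp G α j

/-- The genus zero second bracket of the transformed fields `t^α(X)`, `t^β(Y)`, as a kernel
depending on `v`. Modulo `O(ε⁴)` this is the second bracket of the one-loop deformed hierarchy. -/
def transformedBracket (G : (Fin n → ℂ) → ℂ) (ε : ℂ) (v : ℝ → Fin n → ℂ) (α β : Fin n) :
    LocalKernel :=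
  bracketOf (S.bracket0 v) v (S.backlund G ε α) (S.backlund G ε β)

/-! ### The deformed second bracket in the coordinates `t`: explicit coefficients

The bracket is `{ , }₂ = { , }'₂ + { , }''₂`; the first summand comes from the term
`(1/24) log det M` of the genus one free energy, the second one from `G`. -/

/-- `w^α_{βγ} = c^{μν}_{μβ} c^α_{νγ} - c^{μν}_γ c^α_{μνβ}`. -/
def w3 (α β γ : Fin n) (t : Fin n → ℂ) : ℂ :=
  ∑ m, ∑ ν, (S.c2 m ν [m, β] t * S.c1 α [ν, γ] t - S.c2 m ν [γ] t * S.c1 α [m, ν, β] t)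

def hCoef (α β : Fin n) (t : Fin n → ℂ) : ℂ :=
  (1 / 12) * ((∑ m, ∑ ν, pd ν (fun s => S.g m ν s * S.c2 α β [m] s) t) +
    (1 / 2) * ∑ m, ∑ ν, S.c2 m ν [ν] t * S.c2 α β [m] t)

def pCoef (α β γ : Fin n) (t : Fin n → ℂ) : ℂ :=
  (1 / 12) * (1 / 2 - S.μ β) * ∑ m, ∑ ν, S.c2 α β [m, ν] t * S.c2 m ν [γ] t

def aCoef (α β γ m ν : Fin n) (t : Fin n → ℂ) : ℂ :=
  (1 / 72) * (1 / 2 - S.μ β) *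
    ((∑ σ, S.η⁻¹ α σ *
      (pds [σ, ν] (S.w3 β γ m) t + pds [σ, γ] (S.w3 β m ν) t + pds [σ, m] (S.w3 β γ ν) t
        - 2 * pds [m, ν] (S.w3 β γ σ) t - 2 * pds [m, γ] (S.w3 β ν σ) t
        - 2 * pds [ν, γ] (S.w3 β m σ) t)) +
    ∑ ξ, ∑ ζ, ∑ σ, S.η⁻¹ ξ ζ *
      (6 * S.c2 α σ [ξ, ζ] t * S.c1 β [σ, γ, m, ν] t
        + 3 * S.c2 α σ [ξ, ζ, γ] t * S.c1 β [σ, m, ν] t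
        + 3 * S.c2 α σ [ξ, ζ, m] t * S.c1 β [σ, γ, ν] t
        + 3 * S.c2 α σ [ξ, ζ, ν] t * S.c1 β [σ, γ, m] t
        + S.c2 α σ [ξ, ζ, γ, m] t * S.c1 β [σ, ν] t
        + S.c2 α σ [ξ, ζ, γ, ν] t * S.c1 β [σ, m] t
        + S.c2 α σ [ξ, ζ, m, ν] t * S.c1 β [σ, γ] t))

def bCoef (α β γ m : Fin n) (t : Fin n → ℂ) : ℂ :=
  (1 / 12) * (1 / 2 - S.μ β) *
    ((∑ σ, S.η⁻¹ α σ *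
      (-2 * pd γ (S.w3 β m σ) t + pd σ (S.w3 β γ m) t - pd m (S.w3 β γ σ) t)) +
    ∑ ξ, ∑ ζ, ∑ σ, S.η⁻¹ ξ ζ *
      (3 * S.c2 α σ [ξ, ζ] t * S.c1 β [σ, γ, m] t
        + (3 / 2) * S.c2 α σ [ξ, ζ, γ] t * S.c1 β [σ, m] t
        + (1 / 2) * S.c2 α σ [ξ, ζ, m] t * S.c1 β [σ, γ] t))

def rCoef (α β γ : Fin n) (t : Fin n → ℂ) : ℂ :=
  (3 / 2) * pd γ (S.hCoef α β) t
    + (1 / 24) * (3 / 2 - S.μ β) * (∑ ν, ∑ m, S.c2 α ν [γ] t * S.c2 β m [ν, m] t)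
    - (1 / 24) * (3 / 2 - S.μ α) * (∑ ν, ∑ m, S.c2 β ν [γ] t * S.c2 α m [ν, m] t)

def fCoef (α β γ : Fin n) (t : Fin n → ℂ) : ℂ :=
  S.rCoef α β γ t + S.pCoef α β γ t + S.pCoef β α γ t - pd γ (S.hCoef α β) t

def qCoef (α β γ m : Fin n) (t : Fin n → ℂ) : ℂ :=
  (1 / 2) * (S.bCoef α β m γ t + S.bCoef β α m γ t)
    + (1 / 2) * pd γ (S.rCoef α β m) t + (1 / 2) * pd m (S.rCoef α β γ) t
    - pds [m, γ] (S.hCoef α β) t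
    - (1 / 2) * pd m (fun s => S.pCoef α β γ s + S.pCoef β α γ s) t

/-- The `ε²`-term of `{t^α(X), t^β(Y)}'₂`. -/
def correction' (t : ℝ → Fin n → ℂ) (α β : Fin n) : LocalKernel :=
  mulX (fun X => S.hCoef α β (t X)) (delta 3) +
  mulX (fun X => ∑ γ, S.rCoef α β γ (t X) * jet 4 t X 1 γ) (delta 2) +
  mulX (fun X => (∑ γ, S.fCoef α β γ (t X) * jet 4 t X 2 γ) +
    ∑ γ, ∑ m, S.qCoef α β γ m (t X) * jet 4 t X 1 γ * jet 4 t X 1 m) (delta 1) +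
  mulX (fun X => (∑ γ, ∑ m, S.bCoef α β γ m (t X) * jet 4 t X 1 γ * jet 4 t X 2 m) +
    (∑ γ, ∑ m, ∑ ν, S.aCoef α β γ m ν (t X) * jet 4 t X 1 γ * jet 4 t X 1 m * jet 4 t X 1 ν) +
    ∑ γ, S.pCoef α β γ (t X) * jet 4 t X 3 γ) (delta 0)

/-- `a^{αβ} = 2 c^{αμ}_γ g^{γβ} ∂_μ G`. -/
def aG (G : (Fin n → ℂ) → ℂ) (α β : Fin n) (t : Fin n → ℂ) : ℂ :=
  2 * ∑ m, ∑ γ, S.c2 α m [γ] t * S.g γ β t * pd m G t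

def bG (G : (Fin n → ℂ) → ℂ) (t : ℝ → Fin n → ℂ) (α β : Fin n) (X : ℝ) : ℂ :=
  (3 / 2) * deriv (fun Y => S.aG G α β (t Y)) X
    + (∑ ρ, ∑ γ, ∑ m, (S.c2 α ρ [m] (t X) * S.g γ β (t X) - S.c2 β ρ [m] (t X) * S.g γ α (t X))
        * pds [γ, ρ] G (t X) * jet 2 t X 1 m)
    + (S.μ α - S.μ β) * ∑ ρ, ∑ γ, ∑ m,
        S.c2 α ρ [γ] (t X) * S.c2 γ β [m] (t X) * pd ρ G (t X) * jet 2 t X 1 m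

def qG (G : (Fin n → ℂ) → ℂ) (t : ℝ → Fin n → ℂ) (α β : Fin n) (X : ℝ) : ℂ :=
  (1 / 2 - S.μ β) * ∑ m, ∑ ν,
    ((∑ σ, ∑ ρ, pds [σ, ρ] G (t X) * S.c2 α σ [m] (t X) * S.c2 β ρ [ν] (t X))
      - (∑ σ, ∑ ρ, pds [σ, ν] G (t X) * S.c2 β σ [ρ] (t X) * S.c2 ρ α [m] (t X))
      + ∑ σ, ∑ ρ, pd σ G (t X) * S.c2 α β [ρ, m] (t X) * S.c2 ρ σ [ν] (t X))
    * jet 2 t X 1 m * jet 2 t X 1 ν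

def eG (G : (Fin n → ℂ) → ℂ) (t : ℝ → Fin n → ℂ) (α β : Fin n) (X : ℝ) : ℂ :=
  S.qG G t α β X + S.qG G t β α X + deriv (S.bG G t α β) X
    - iteratedDeriv 2 (fun Y => S.aG G α β (t Y)) X

/-- `{t^α(X), t^β(Y)}''₂` (without the factor `ε²`). -/
def correction'' (G : (Fin n → ℂ) → ℂ) (t : ℝ → Fin n → ℂ) (α β : Fin n) : LocalKernel :=
  mulX (fun X => S.aG G α β (t X)) (delta 3) + mulX (S.bG G t α β) (delta 2) +
    mulX (S.eG G t α β) (delta 1) + mulX (fun X => deriv (S.qG G t α β) X) (delta 0)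

/-- The full deformed second Poisson bracket `{t^α(X), t^β(Y)}₂` in the one-loop approximation
(the terms of order at most `ε²`). -/
def bracket2 (G : (Fin n → ℂ) → ℂ) (ε : ℂ) (t : ℝ → Fin n → ℂ) (α β : Fin n) : LocalKernel :=
  S.bracket0 t α β + ε ^ 2 • (S.correction' t α β + S.correction'' G t α β)

/-- The central charge `c = 12/(1-d)² · [n/2 - 2 ∑ μ_α²]`. -/
def centralCharge : ℂ := 12 / (1 - S.d) ^ 2 * ((n : ℂ) / 2 - 2 * ∑ α, S.μ α ^ 2)

end WDVVSolution

end OneLoop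

end

/-!
The upper index `n` is the lower index `1`, and `∂_1` is the unit field. Hence `c^{nβ}_γ = δ^β_γ`,
all `c` with an upper index `n` and at least four indices vanish, and `g^{nβ} = E^β`.

*The explicit bracket.* For both indices equal to `n` the coefficients therefore collapse: of the
terms with `δ'''`, `δ''`, `δ'`, `δ` at order `ε²` only two constants in front of `δ'''` are left,
`h^{nn} = n (3 - d) / 24` (`hCoef_last`) and `a^{nn} = 2 E(G)` (`aG_last`). The central charge is
thus equivalent to the scaling law `E(G) = n d / 48 - ¼ ∑ μ_α²` (`euler_G`). In canonical
coordinates `E = ∑ u_i ∂/∂u_i`, so that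
`E(log τ_I) = ∑ u_i H_i = ¼ ∑ V_{ij}² = -¼ tr V² = -¼ ∑ μ_α²`, because the normalized
idempotents are an orthonormal frame in which `V` is antisymmetric and similar to `diag μ`
(`sum_V_sq`, `sum_u_H`); and the Jacobian of the canonical coordinates scales with the
weight `∑ q_α = n d / 2` (`hasDerivAt_det_jacobian`). This is valid where the `u_i` are distinct,
which is dense, and extends to all of `U` by continuity.

*The transformed bracket.* Since `∂/∂T^{1,0} = ∂/∂X`, the correction of `t^n` is `w = ∂_X² 𝓕` with
`𝓕 = (1/24) log det M + G`, for a local branch of the logarithm (`wLow_zero_eventuallyEq`). The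
field `v^n` generates `δv = E ψ' + k v_X ψ` with `k = (1 - d) / 2`, and `𝓕` has constant
derivatives along the Euler vector field and along the dilation of `v_X` (`euler_freeEnergy`,
`sum_jpd_one_freeEnergy`). As variations commute with total derivatives (`fderiv_totalD_jet`),
`{w(X), v^n(Y)}` is the operator `ψ ↦ ∂_X² (k ψ 𝓕_X + c ψ' + A ψ'')` with a constant `c` and the
function `A = E^γ ∂𝓕/∂v^γ_X`. The adjoint form of the same commutation (`adjointVariation_totalD`)
gives `{v^n(X), w(Y)}` as the negative transpose of this operator, so that `A` drops out of the sum
and the Virasoro bracket of `w` with twice the constant `c` remains (`variation_add_adjoint`). The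
bracket of `w` with itself is of order `ε⁴`.
-/

open Filter OneLoop.LocalKernel

/-! ### Partial derivatives and homogeneity -/

namespace OneLoop

section PartialDerivatives

variable {n : ℕ} {f g : (Fin n → ℂ) → ℂ} {t : Fin n → ℂ} {U : Set (Fin n → ℂ)}

theorem pd_congr (h : f =ᶠ[𝓝 t] g) (α : Fin n) : pd α f t = pd α g t := by
  simp only [pd, h.fderiv_eq]

theorem analyticAt_pd (hf : AnalyticAt ℂ f t) (α : Fin n) : AnalyticAt ℂ (pd α f) t :=
  ((ContinuousLinearMap.apply ℂ ℂ (Pi.single α 1 : Fin n → ℂ)).analyticAt _).comp hf.fderiv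

theorem analyticAt_pds (hf : AnalyticAt ℂ f t) (l : List (Fin n)) : AnalyticAt ℂ (pds l f) t := by
  induction l with
  | nil => exact hf
  | cons α l ih => exact analyticAt_pd ih α

theorem pd_comm (hf : AnalyticAt ℂ f t) (α β : Fin n) :
    pd α (pd β f) t = pd β (pd α f) t := by
  have key : ∀ a b : Fin n, pd a (pd b f) t =
      fderiv ℂ (fderiv ℂ f) t (Pi.single a 1) (Pi.single b 1) := by
    intro a b
    have h : HasFDerivAt (pd b f) _ t :=
      hf.fderiv.differentiableAt.hasFDerivAt.clm_apply
        (hasFDerivAt_const (Pi.single b 1 : Fin n → ℂ) t)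
    simp [pd, h.fderiv]
  rw [key, key]
  exact (hf.contDiffAt.isSymmSndFDerivAt (n := ω) (by simp)).eq _ _

theorem pd_add (hf : DifferentiableAt ℂ f t) (hg : DifferentiableAt ℂ g t) (α : Fin n) :
    pd α (fun s => f s + g s) t = pd α f t + pd α g t := by
  simp [pd, fderiv_fun_add hf hg]

theorem pd_mul (hf : DifferentiableAt ℂ f t) (hg : DifferentiableAt ℂ g t) (α : Fin n) :
    pd α (fun s => f s * g s) t = f t * pd α g t + pd α f t * g t := by
  simp [pd, fderiv_fun_mul hf hg, mul_comm]

theorem pd_sum {ι : Type*} (s : Finset ι) {f : ι → (Fin n → ℂ) → ℂ}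
    (hf : ∀ i ∈ s, DifferentiableAt ℂ (f i) t) (α : Fin n) :
    pd α (fun x => ∑ i ∈ s, f i x) t = ∑ i ∈ s, pd α (f i) t := by
  simp [pd, fderiv_fun_sum hf]

@[simp] theorem pd_const (c : ℂ) (α : Fin n) : pd α (fun _ => c) t = 0 := by
  simp [pd]

theorem pd_coord (α β : Fin n) : pd α (fun s : Fin n → ℂ => s β) t = if β = α then 1 else 0 := by
  have h : HasFDerivAt (fun s : Fin n → ℂ => s β) (ContinuousLinearMap.proj β) t :=
    (ContinuousLinearMap.proj (R := ℂ) (φ := fun _ : Fin n => ℂ) β).hasFDerivAt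
  simp [pd, h.fderiv, Pi.single_apply]

theorem pd_congr_on (hU : IsOpen U) (h : Set.EqOn f g U) (ht : t ∈ U) (α : Fin n) :
    pd α f t = pd α g t :=
  pd_congr (h.eventuallyEq_of_mem (hU.mem_nhds ht)) α

theorem pds_congr_on (hU : IsOpen U) (h : Set.EqOn f g U) (l : List (Fin n)) :
    Set.EqOn (pds l f) (pds l g) U := by
  induction l with
  | nil => exact h
  | cons α l ih => exact fun s hs => pd_congr_on hU ih hs α

theorem pds_append (l l' : List (Fin n)) (f : (Fin n → ℂ) → ℂ) :
    pds (l ++ l') f = pds l (pds l' f) := by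
  induction l with
  | nil => rfl
  | cons α l ih => simp [pds, ih]

/-- Iterated partial derivatives of an analytic function do not depend on their order. -/
theorem pds_perm (hU : IsOpen U) (hf : AnalyticOnNhd ℂ f U) {l l' : List (Fin n)}
    (h : l.Perm l') : Set.EqOn (pds l f) (pds l' f) U := by
  induction h with
  | nil => exact fun _ _ => rfl
  | cons α _ ih => exact fun s hs => pd_congr_on hU ih hs α
  | swap α β l => exact fun s hs => pd_comm (analyticAt_pds (hf s hs) l) _ _
  | trans _ _ h₁ h₂ => exact h₁.trans h₂

theorem pds_const_on (hU : IsOpen U) {c : ℂ} (h : ∀ s ∈ U, f s = c) {l : List (Fin n)}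
    (hl : l ≠ []) (ht : t ∈ U) : pds l f t = 0 := by
  rw [pds_congr_on hU (g := fun _ => c) h l ht]
  have : ∀ l : List (Fin n), ∀ c : ℂ, l ≠ [] → pds l (fun _ => c) = fun _ => 0 := by
    intro l
    induction l with
    | nil => simp
    | cons α l ih =>
      intro c _
      rcases eq_or_ne l [] with rfl | hl
      · ext s; simp [pds]
      · ext s; simp [pds, ih c hl]
  rw [this l c hl]

/-- The derivative along a vector is the corresponding combination of partial derivatives. -/
theorem fderiv_eq_sum_pd (f : (Fin n → ℂ) → ℂ) (t x : Fin n → ℂ) :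
    fderiv ℂ f t x = ∑ α, x α * pd α f t := by
  conv_lhs => rw [pi_eq_sum_univ' x]
  simp [pd, map_sum]

/-- If the entries of a matrix depend on one parameter and have logarithmic derivatives
`p_α + q_β`, then its determinant has logarithmic derivative `∑ p_α + ∑ q_α`. -/
theorem hasDerivAt_det {𝕜 : Type*} [NontriviallyNormedField 𝕜] {M : 𝕜 → Matrix (Fin n) (Fin n) 𝕜}
    {s : 𝕜} {p q : Fin n → 𝕜}
    (h : ∀ α β, HasDerivAt (fun x => M x α β) ((p α + q β) * M s α β) s) :
    HasDerivAt (fun x => (M x).det) ((∑ α, p α + ∑ α, q α) * (M s).det) s := by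
  simp only [Matrix.det_apply]
  rw [Finset.mul_sum]
  refine HasDerivAt.fun_sum fun σ _ => ?_
  have h1 := HasDerivAt.fun_finsetProd (u := Finset.univ) (x := s)
    fun i (_ : i ∈ Finset.univ) => h (σ i) i
  have h2 := h1.const_smul (Equiv.Perm.sign σ : ℤˣ)
  convert! h2 using 1
  rw [mul_smul_comm]
  congr 1
  have h3 : ∀ i, (∏ j ∈ Finset.univ.erase i, M s (σ j) j) • ((p (σ i) + q i) * M s (σ i) i) =
      (p (σ i) + q i) * ∏ j, M s (σ j) j := by
    intro i
    rw [← Finset.mul_prod_erase Finset.univ (fun j => M s (σ j) j) (Finset.mem_univ i), smul_eq_mul]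
    ring
  simp only [h3]
  rw [← Finset.sum_mul, Finset.sum_add_distrib, Equiv.sum_comp σ p]

end PartialDerivatives

namespace WDVVSolution

variable {n : ℕ} [NeZero n] (S : WDVVSolution n) {t : Fin n → ℂ}

theorem analyticAt_pds_F (ht : t ∈ S.U) (l : List (Fin n)) : AnalyticAt ℂ (pds l S.F) t :=
  analyticAt_pds (S.analytic_F t ht) l

theorem pds_F_perm (ht : t ∈ S.U) {l l' : List (Fin n)} (h : l.Perm l') :
    pds l S.F t = pds l' S.F t :=
  pds_perm S.isOpen_U S.analytic_F h ht

/-- The derivatives of `F` of order at least four that involve `t^1` vanish. -/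
theorem pds_unit (ht : t ∈ S.U) (α β γ : Fin n) (l : List (Fin n)) :
    pds (0 :: α :: β :: γ :: l) S.F t = 0 := by
  have hp : (0 :: α :: β :: γ :: l).Perm ((γ :: l) ++ [0, α, β]) :=
    List.perm_append_comm (l₁ := [0, α, β]) (l₂ := γ :: l)
  rw [S.pds_F_perm ht hp, pds_append]
  exact pds_const_on S.isOpen_U (fun s hs => S.unit s hs α β) (by simp) ht

theorem inv_η_mul_η : S.η⁻¹ * S.η = 1 := Matrix.nonsing_inv_mul _ S.η_nondeg

/-- The derivative along the Euler vector field commutes with `∂_α` up to the weight `1 - q_α`. -/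
theorem euler_pd {f : (Fin n → ℂ) → ℂ} (hf : AnalyticAt ℂ f t) (α : Fin n) :
    pd α (fun s => ∑ ε, S.E ε s * pd ε f s) t =
      (∑ ε, S.E ε t * pd ε (pd α f) t) + (1 - S.q α) * pd α f t := by
  have hE : ∀ ε, DifferentiableAt ℂ (S.E ε) t := fun ε => by
    unfold E; fun_prop
  have hpE : ∀ ε, pd α (S.E ε) t = if ε = α then 1 - S.q ε else 0 := fun ε => by
    have : S.E ε = fun s => (fun s : Fin n → ℂ => (1 - S.q ε)) s * s ε + (fun _ => S.r ε) s := rfl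
    rw [this, pd_add (by fun_prop) (by fun_prop), pd_mul (by fun_prop) (by fun_prop), pd_coord]
    simp
  rw [pd_sum (f := fun ε s => S.E ε s * pd ε f s) _
    fun ε _ => (hE ε).mul (analyticAt_pd hf ε).differentiableAt]
  have : ∀ ε, pd α (fun s => S.E ε s * pd ε f s) t =
      S.E ε t * pd ε (pd α f) t + (if ε = α then 1 - S.q ε else 0) * pd ε f t := fun ε => by
    rw [pd_mul (hE ε) (analyticAt_pd hf ε).differentiableAt, hpE, pd_comm hf]
  simp only [this, Finset.sum_add_distrib, ite_mul, zero_mul, Finset.sum_ite_eq', Finset.mem_univ,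
    if_true]

/-- The third derivatives of `F` are homogeneous: `E(∂_α∂_β∂_γ F) = (q_α + q_β + q_γ - d)
∂_α∂_β∂_γ F`. -/
theorem euler_pds_three (ht : t ∈ S.U) (α β γ : Fin n) :
    ∑ ε, S.E ε t * pd ε (pds [α, β, γ] S.F) t =
      (S.q α + S.q β + S.q γ - S.d) * pds [α, β, γ] S.F t := by
  have hd : ∀ s ∈ S.U, ∀ l, DifferentiableAt ℂ (pds l S.F) s := fun s hs l =>
    (S.analyticAt_pds_F hs l).differentiableAt
  have h1 : ∀ s ∈ S.U, ∑ ε, S.E ε s * pd ε (pds [γ] S.F) s =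
      (2 - S.d + S.q γ) * pds [γ] S.F s + ((∑ ε, S.A γ ε * s ε) + S.B γ) := by
    intro s hs
    have e1 := S.euler_pd (S.analyticAt_pds_F hs []) γ
    have e2 : pd γ (fun s => ∑ ε, S.E ε s * pd ε S.F s) s =
        (3 - S.d) * pd γ S.F s + ((∑ ε, S.A γ ε * s ε) + S.B γ) := by
      rw [pd_congr_on (g := fun t => (3 - S.d) * S.F t + ((1 / 2) * ∑ α, ∑ β, S.A α β * t α * t β +
        (∑ α, S.B α * t α + S.C))) S.isOpen_U (fun x hx => by
          simp only [E]; rw [S.quasihom x hx]; ring) hs]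
      have hq : ∀ α β, pd γ (fun t : Fin n → ℂ => S.A α β * t α * t β) s =
          (if β = γ then S.A α β * s α else 0) + (if α = γ then S.A α β * s β else 0) := by
        intro α β
        rw [pd_mul (by fun_prop) (by fun_prop), pd_mul (by fun_prop) (by fun_prop), pd_coord,
          pd_coord]
        simp
      have hb : ∀ α, pd γ (fun t : Fin n → ℂ => S.B α * t α) s = if α = γ then S.B α else 0 := by
        intro α
        rw [pd_mul (by fun_prop) (by fun_prop), pd_coord]
        simp
      have := hd s hs []
      simp only [pds] at this
      rw [pd_add (by fun_prop) (by fun_prop), pd_mul (by fun_prop) (by fun_prop),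
        pd_add (by fun_prop) (by fun_prop), pd_mul (by fun_prop) (by fun_prop),
        pd_add (by fun_prop) (by fun_prop), pd_sum _ (fun _ _ => by fun_prop)]
      rw [pd_sum _ (fun _ _ => by fun_prop)]
      simp only [hb]
      have hs2 : ∀ α, pd γ (fun t : Fin n → ℂ => ∑ β, S.A α β * t α * t β) s =
          S.A α γ * s α + if α = γ then ∑ β, S.A α β * s β else 0 := by
        intro α
        rw [pd_sum _ (fun _ _ => by fun_prop)]
        simp only [hq, Finset.sum_add_distrib]
        congr 1
        · simp
        · split_ifs <;> simp
      simp only [hs2, Finset.sum_add_distrib]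
      have hsym : ∑ x, S.A x γ * s x = ∑ x, S.A γ x * s x :=
        Finset.sum_congr rfl fun x _ => by rw [S.A_symm.apply]
      rw [hsym]
      simp
      ring
    simp only [pds] at e1 ⊢
    linear_combination e2 - e1
  have h2 : ∀ s ∈ S.U, ∑ ε, S.E ε s * pd ε (pds [β, γ] S.F) s =
      (1 - S.d + S.q β + S.q γ) * pds [β, γ] S.F s + S.A γ β := by
    intro s hs
    have e1 := S.euler_pd (S.analyticAt_pds_F hs [γ]) β
    rw [pd_congr_on S.isOpen_U h1 hs] at e1
    have hl : ∀ ε, pd β (fun t : Fin n → ℂ => S.A γ ε * t ε) s = if ε = β then S.A γ ε else 0 := by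
      intro α
      rw [pd_mul (by fun_prop) (by fun_prop), pd_coord]
      simp
    have := hd s hs [γ]
    rw [pd_add (by fun_prop) (by fun_prop), pd_mul (by fun_prop) (by fun_prop),
      pd_add (f := fun s => ∑ ε, S.A γ ε * s ε) (by fun_prop) (by fun_prop),
      pd_sum _ (fun _ _ => by fun_prop),
      pd_const (2 - S.d + S.q γ)] at e1
    simp only [hl, Finset.sum_ite_eq', Finset.mem_univ, if_true, pd_const, zero_mul,
      add_zero] at e1
    simp only [pds] at e1 ⊢
    linear_combination -e1
  have e1 := S.euler_pd (S.analyticAt_pds_F ht [β, γ]) α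
  rw [pd_congr_on S.isOpen_U h2 ht] at e1
  have := hd t ht [β, γ]
  rw [pd_add (by fun_prop) (by fun_prop), pd_mul (by fun_prop) (by fun_prop),
    pd_const (1 - S.d + S.q β + S.q γ)] at e1
  simp only [pd_const, zero_mul, add_zero] at e1
  simp only [pds] at e1 ⊢
  linear_combination -e1

end WDVVSolution
end OneLoop

/-! ### The scaling law of the G-function -/

namespace OneLoop

theorem hasDerivAt_line {n : ℕ} {f : (Fin n → ℂ) → ℂ} {t : Fin n → ℂ} (hf : AnalyticAt ℂ f t)
    (e : Fin n → ℂ) : HasDerivAt (fun x : ℂ => f (t + x • e)) (∑ α, e α * pd α f t) 0 := by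
  have h1 : HasDerivAt (fun x : ℂ => t + x • e) e 0 := by
    simpa using ((hasDerivAt_id (0 : ℂ)).smul_const e).const_add t
  have h2 : HasFDerivAt f (fderiv ℂ f t) (t + (0 : ℂ) • e) := by
    simpa using hf.differentiableAt.hasFDerivAt
  rw [← fderiv_eq_sum_pd]
  exact h2.comp_hasDerivAt (0 : ℂ) h1

/-- Logarithmic differentiation of the relation `exp(g)^24 = τ^24 J`. -/
theorem deriv_log_of_exp_eq {g τ J : ℂ → ℂ} {g' z q x : ℂ} (hg : HasDerivAt g g' x)
    (hτ : HasDerivAt τ (z * τ x) x) (hJ : HasDerivAt J (q * J x) x)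
    (h : ∀ᶠ y in 𝓝 x, Complex.exp (g y) ^ 24 = τ y ^ 24 * J y) : g' = z + q / 24 := by
  have h1 := hg.cexp.fun_pow 24
  have h2 : HasDerivAt (fun y => Complex.exp (g y) ^ 24) _ x :=
    ((hτ.fun_pow 24).fun_mul hJ).congr_of_eventuallyEq h
  have h3 := h1.unique h2
  have h4 := h.self_of_nhds
  have h5 : (24 * g') * Complex.exp (g x) ^ 24 = (24 * z + q) * Complex.exp (g x) ^ 24 := by
    rw [add_mul, h4]
    norm_num at h3
    linear_combination h3 - 24 * g' * h4
  have h6 := mul_right_cancel₀ (pow_ne_zero 24 (Complex.exp_ne_zero _)) h5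
  linear_combination h6 / 24

namespace WDVVSolution

variable {n : ℕ} [NeZero n] {S : WDVVSolution n} {t : Fin n → ℂ}

section Antidiagonal

variable (hη : ∀ α β : Fin n, S.η α β = if β = Fin.rev α then 1 else 0)
include hη

theorem η_inv_antidiag : S.η⁻¹ = S.η := by
  refine Matrix.inv_eq_left_inv ?_
  ext α β
  simp only [Matrix.mul_apply, hη, Matrix.one_apply, ite_mul, one_mul, zero_mul,
    Finset.sum_ite_eq', Finset.mem_univ, if_true, Fin.rev_rev, eq_comm]

theorem η_inv_apply (α β : Fin n) : S.η⁻¹ α β = if β = Fin.rev α then 1 else 0 := by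
  rw [η_inv_antidiag hη, hη]

theorem q_add_q_rev (ht : t ∈ S.U) (α : Fin n) : S.q α + S.q (Fin.rev α) = S.d := by
  have h := S.euler_pds_three ht 0 α (Fin.rev α)
  rw [S.unit t ht, hη, if_pos rfl, S.q_zero] at h
  have h0 : ∀ ε, pd ε (pds [0, α, Fin.rev α] S.F) t = 0 := fun ε => by
    rw [pd_congr_on (g := fun _ => S.η α (Fin.rev α)) S.isOpen_U
      (fun s hs => S.unit s hs α _) ht, pd_const]
  simp only [h0, mul_zero, Finset.sum_const_zero] at h
  linear_combination -h

theorem q_last (ht : t ∈ S.U) : S.q S.last = S.d := by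
  simpa [S.q_zero, last] using q_add_q_rev hη ht 0

theorem sum_q (ht : t ∈ S.U) : ∑ α, S.q α = n * S.d / 2 := by
  have h : ∑ α, (S.q α + S.q (Fin.rev α)) = n * S.d := by
    simp [q_add_q_rev hη ht]
  rw [Finset.sum_add_distrib] at h
  have h' : ∑ α, S.q (Fin.rev α) = ∑ α, S.q α := Equiv.sum_comp Fin.revPerm S.q
  rw [h'] at h
  linear_combination h / 2

theorem μ_rev (ht : t ∈ S.U) (α : Fin n) : S.μ (Fin.rev α) = -S.μ α := by
  have := q_add_q_rev hη ht α
  unfold μ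
  linear_combination this

theorem c1_eq (α : Fin n) (l : List (Fin n)) : S.c1 α l = pds (Fin.rev α :: l) S.F := by
  ext t
  simp [c1, η_inv_apply hη]

theorem c2_eq (α β : Fin n) (l : List (Fin n)) :
    S.c2 α β l = pds (Fin.rev α :: Fin.rev β :: l) S.F := by
  ext t
  simp [c2, η_inv_apply hη]

end Antidiagonal

section Canonical

variable {W : Set (Fin n → ℂ)} {u : (Fin n → ℂ) → Fin n → ℂ} {s : Fin n → ℂ}

theorem jacobian_mul_dtdu (hu : S.IsCanonical W u) (hs : s ∈ W) :
    (Matrix.of fun i α => pd α (fun s => u s i) s) * S.dtdu u s = 1 :=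
  Matrix.mul_nonsing_inv _ (hu.jacobian s hs).isUnit

theorem dtdu_mul_jacobian (hu : S.IsCanonical W u) (hs : s ∈ W) :
    S.dtdu u s * (Matrix.of fun i α => pd α (fun s => u s i) s) = 1 :=
  Matrix.nonsing_inv_mul _ (hu.jacobian s hs).isUnit

/-- The Euler vector field in canonical coordinates is `∑ u_i ∂/∂u_i`. -/
theorem E_eq_sum_canonical (hu : S.IsCanonical W u) (hs : s ∈ W) (ε : Fin n) :
    S.E ε s = ∑ i, S.dtdu u s ε i * u s i := by
  have h : (Matrix.of fun i α => pd α (fun s => u s i) s).mulVec (fun ε => S.E ε s) = u s := by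
    ext i
    rw [← hu.euler s hs i]
    simp [Matrix.mulVec, dotProduct, mul_comm]
  have h2 := congrArg (fun v => (S.dtdu u s).mulVec v ε) h
  simp only [Matrix.mulVec_mulVec, dtdu_mul_jacobian hu hs, Matrix.one_mulVec] at h2
  rw [h2]
  rfl

theorem euler_eq_sum_canonical (hu : S.IsCanonical W u) (hs : s ∈ W) (f : (Fin n → ℂ) → ℂ) :
    ∑ ε, S.E ε s * pd ε f s = ∑ i, u s i * S.pdu u i f s := by
  simp only [E_eq_sum_canonical hu hs, pdu, Finset.sum_mul, Finset.mul_sum]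
  rw [Finset.sum_comm]
  exact Finset.sum_congr rfl fun _ _ => Finset.sum_congr rfl fun _ _ => by ring

/-- The Jacobian of the canonical coordinates is homogeneous of degree `∑ q_α` along the Euler
vector field. -/
theorem hasDerivAt_det_jacobian (hW : IsOpen W) (hu : S.IsCanonical W u) (hs : s ∈ W) :
    HasDerivAt (fun x : ℂ => (Matrix.of fun i α =>
        pd α (fun s => u s i) (s + x • fun ε => S.E ε s)).det)
      ((∑ α, S.q α) * (Matrix.of fun i α => pd α (fun s => u s i) s).det) 0 := by
  have h := hasDerivAt_det (𝕜 := ℂ) (s := 0) (p := fun _ : Fin n => 0) (q := S.q)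
    (M := fun x => Matrix.of fun i α => pd α (fun s => u s i) (s + x • fun ε => S.E ε s)) ?_
  · simpa using h
  · intro i α
    have h1 := hasDerivAt_line (analyticAt_pd (hu.analytic i s hs) α) fun ε => S.E ε s
    have h2 := S.euler_pd (hu.analytic i s hs) α
    rw [pd_congr_on hW (fun x hx => hu.euler x hx i) hs] at h2
    convert! h1 using 1
    simp only [Matrix.of_apply, zero_smul, add_zero, zero_add]
    linear_combination h2

theorem V_eq_mul (i j : Fin n) : S.V u s i j = (Matrix.of (S.ψ u s) * Matrix.diagonal S.μ *
    (S.η⁻¹ * (Matrix.of (S.ψ u s)).transpose)) i j := by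
  rw [Matrix.mul_apply]
  simp only [V, Matrix.mul_diagonal, Matrix.of_apply]
  simp only [Matrix.mul_apply, Matrix.transpose_apply, Matrix.of_apply]
  exact Finset.sum_congr rfl fun α _ => by ring

variable (hη : ∀ α β : Fin n, S.η α β = if β = Fin.rev α then 1 else 0)
include hη

/-- The invariant metric is diagonal in canonical coordinates. -/
theorem metric_canonical (hu : S.IsCanonical W u) (hs : s ∈ W) (hsU : s ∈ S.U) :
    (S.dtdu u s).transpose * S.η * S.dtdu u s = Matrix.diagonal (S.ηdiag u s) := by
  have hexp : ∀ i j, ((S.dtdu u s).transpose * S.η * S.dtdu u s) i j =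
      ∑ α, ∑ β, S.η α β * S.dtdu u s α i * S.dtdu u s β j := by
    intro i j
    simp only [Matrix.mul_apply, Matrix.transpose_apply, Finset.sum_mul]
    rw [Finset.sum_comm]
    exact Finset.sum_congr rfl fun _ _ => Finset.sum_congr rfl fun _ _ => by ring
  ext i j
  rw [hexp]
  rcases eq_or_ne i j with rfl | hij
  · simp [ηdiag]
  · -- the pairing with the unit of the product of two distinct idempotents
    have h := congrFun (hu.mul_eq s hs i j) S.last
    rw [if_neg hij] at h
    rw [Matrix.diagonal_apply_ne _ hij]
    simp only [mul, Pi.zero_apply] at h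
    rw [← h]
    refine Finset.sum_congr rfl fun α _ => Finset.sum_congr rfl fun β _ => ?_
    rw [c1_eq hη, last, Fin.rev_rev, S.unit s hsU]

theorem ηdiag_ne_zero (hu : S.IsCanonical W u) (hs : s ∈ W) (hsU : s ∈ S.U) (i : Fin n) :
    S.ηdiag u s i ≠ 0 := by
  have h := congrArg Matrix.det (metric_canonical hη hu hs hsU)
  rw [Matrix.det_mul, Matrix.det_mul, Matrix.det_transpose, Matrix.det_diagonal] at h
  have hK : (S.dtdu u s).det ≠ 0 := by
    intro h0
    have := congrArg Matrix.det (jacobian_mul_dtdu hu hs)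
    simp [Matrix.det_mul, h0] at this
  have : ∏ i, S.ηdiag u s i ≠ 0 := by
    rw [← h]
    exact mul_ne_zero (mul_ne_zero hK S.η_nondeg.ne_zero) hK
  exact Finset.prod_ne_zero_iff.mp this i (Finset.mem_univ i)

/-- The normalized idempotents form an orthonormal frame. -/
theorem ψ_orthonormal (hu : S.IsCanonical W u) (hs : s ∈ W) (hsU : s ∈ S.U) :
    Matrix.of (S.ψ u s) * (S.η⁻¹ * (Matrix.of (S.ψ u s)).transpose) = 1 := by
  set R : Matrix (Fin n) (Fin n) ℂ :=
    Matrix.diagonal fun i => ((S.ηdiag u s i) ^ (1 / 2 : ℂ))⁻¹ with hR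
  have hψ : Matrix.of (S.ψ u s) = R * ((S.dtdu u s).transpose * S.η) := by
    ext i α
    rw [hR, Matrix.diagonal_mul]
    simp only [Matrix.of_apply, ψ, Matrix.mul_apply, Matrix.transpose_apply, div_eq_inv_mul]
    congr 1
    exact Finset.sum_congr rfl fun β _ => by rw [S.η_symm.apply, mul_comm]
  have hRt : R.transpose = R := Matrix.diagonal_transpose _
  rw [hψ, Matrix.transpose_mul, Matrix.transpose_mul, hRt, Matrix.transpose_transpose,
    S.η_symm.eq]
  calc R * ((S.dtdu u s).transpose * S.η) * (S.η⁻¹ * (S.η * S.dtdu u s * R))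
      = R * ((S.dtdu u s).transpose * S.η * ((S.η⁻¹ * S.η) * S.dtdu u s)) * R := by
        simp only [Matrix.mul_assoc]
    _ = R * Matrix.diagonal (S.ηdiag u s) * R := by
        rw [S.inv_η_mul_η, Matrix.one_mul, metric_canonical hη hu hs hsU]
    _ = 1 := by
        rw [hR, Matrix.diagonal_mul_diagonal, Matrix.diagonal_mul_diagonal, ← Matrix.diagonal_one]
        congr 1
        ext i
        have h0 := ηdiag_ne_zero hη hu hs hsU i
        have h1 : S.ηdiag u s i ^ (1 / 2 : ℂ) ≠ 0 := by simp [Complex.cpow_eq_zero_iff, h0]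
        have h2 : S.ηdiag u s i ^ (1 / 2 : ℂ) * S.ηdiag u s i ^ (1 / 2 : ℂ) = S.ηdiag u s i := by
          rw [← Complex.cpow_add _ _ h0]
          norm_num
        field_simp
        rw [sq, h2]

theorem V_antisymm (hsU : s ∈ S.U) (i j : Fin n) : S.V u s j i = -S.V u s i j := by
  have h : ∀ i j, S.V u s i j = ∑ α, S.μ α * S.ψ u s i α * S.ψ u s j (Fin.rev α) := by
    intro i j
    simp [V, η_inv_apply hη]
  rw [h, h, ← Equiv.sum_comp Fin.revPerm, ← Finset.sum_neg_distrib]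
  refine Finset.sum_congr rfl fun α _ => ?_
  simp only [Fin.revPerm_apply, Fin.rev_rev, μ_rev hη hsU]
  ring

theorem sum_V_sq (hu : S.IsCanonical W u) (hs : s ∈ W) (hsU : s ∈ S.U) :
    ∑ i, ∑ j, S.V u s i j ^ 2 = -∑ α, S.μ α ^ 2 := by
  set Ψ := Matrix.of (S.ψ u s)
  set Φ := S.η⁻¹ * Ψ.transpose
  have h1 : Ψ * Φ = 1 := ψ_orthonormal hη hu hs hsU
  have h2 : Φ * Ψ = 1 := mul_eq_one_comm.mp h1
  have h3 : ∑ i, ∑ j, S.V u s i j * S.V u s j i = ∑ α, S.μ α ^ 2 := by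
    have : ∑ i, ∑ j, S.V u s i j * S.V u s j i =
        Matrix.trace ((Ψ * Matrix.diagonal S.μ * Φ) * (Ψ * Matrix.diagonal S.μ * Φ)) := by
      simp only [Matrix.trace, Matrix.diag_apply, Matrix.mul_apply (M := Ψ * _ * Φ)]
      simp only [V_eq_mul, Ψ, Φ]
    rw [this]
    calc Matrix.trace ((Ψ * Matrix.diagonal S.μ * Φ) * (Ψ * Matrix.diagonal S.μ * Φ))
        = Matrix.trace (Ψ * (Matrix.diagonal S.μ * (Φ * Ψ) * Matrix.diagonal S.μ * Φ)) := by
          simp only [Matrix.mul_assoc]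
      _ = Matrix.trace (Matrix.diagonal S.μ * Matrix.diagonal S.μ) := by
          rw [Matrix.trace_mul_comm, Matrix.mul_assoc, h2, Matrix.mul_one, Matrix.mul_one]
      _ = ∑ α, S.μ α ^ 2 := by
          rw [Matrix.diagonal_mul_diagonal, Matrix.trace_diagonal]
          exact Finset.sum_congr rfl fun _ _ => (sq _).symm
  rw [← h3, ← Finset.sum_neg_distrib]
  refine Finset.sum_congr rfl fun i _ => ?_
  rw [← Finset.sum_neg_distrib]
  exact Finset.sum_congr rfl fun j _ => by rw [V_antisymm hη hsU i j]; ring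

/-- Where the canonical coordinates are distinct, `∑ u_i H_i = -¼ ∑ μ_α²`. -/
theorem sum_u_H (hu : S.IsCanonical W u) (hs : s ∈ W) (hsU : s ∈ S.U)
    (hne : ∀ i j, i ≠ j → u s i ≠ u s j) :
    ∑ i, u s i * S.H u i s = -(1 / 4) * ∑ α, S.μ α ^ 2 := by
  have hdiag : ∀ i, S.V u s i i = 0 := fun i => by
    have := V_antisymm hη hsU (u := u) i i
    linear_combination this / 2
  have hH : ∀ i, S.H u i s = (1 / 2) * ∑ j, S.V u s i j ^ 2 / (u s i - u s j) := fun i => by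
    rw [H, Finset.sum_erase]
    simp
  set Z := ∑ i, ∑ j, u s i * (S.V u s i j ^ 2 / (u s i - u s j)) with hZ
  have hZ2 : Z = ∑ i, ∑ j, u s j * (S.V u s j i ^ 2 / (u s j - u s i)) := by
    rw [hZ, Finset.sum_comm]
  have hZZ : Z + Z = ∑ i, ∑ j, S.V u s i j ^ 2 := by
    nth_rewrite 2 [hZ2]
    rw [hZ, ← Finset.sum_add_distrib]
    refine Finset.sum_congr rfl fun i _ => ?_
    rw [← Finset.sum_add_distrib]
    refine Finset.sum_congr rfl fun j _ => ?_
    rcases eq_or_ne i j with rfl | hij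
    · simp [hdiag]
    · have h1 : u s i - u s j ≠ 0 := sub_ne_zero.mpr (hne i j hij)
      have h2 : u s j - u s i ≠ 0 := sub_ne_zero.mpr (hne j i hij.symm)
      rw [V_antisymm hη hsU i j]
      field_simp
      ring
  have hZ3 : ∑ i, u s i * S.H u i s = (1 / 2) * Z := by
    simp only [hH, hZ, Finset.mul_sum]
    exact Finset.sum_congr rfl fun _ _ => Finset.sum_congr rfl fun _ _ => by ring
  rw [hZ3]
  linear_combination hZZ / 4 + (sum_V_sq hη hu hs hsU) / 4

/-- The scaling law of the G-function at the points of a canonical chart with distinct canonical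
coordinates. -/
theorem euler_G_of_canonical {G τ : (Fin n → ℂ) → ℂ} (hG : AnalyticAt ℂ G s) (hW : IsOpen W)
    (hu : S.IsCanonical W u) (hτ : S.IsTau W u τ)
    (hf : ∀ s ∈ W, Complex.exp (G s) ^ 24 * (S.dtdu u s).det = τ s ^ 24)
    (hs : s ∈ W) (hsU : s ∈ S.U) (hne : ∀ i j, i ≠ j → u s i ≠ u s j) :
    ∑ ε, S.E ε s * pd ε G s = n * S.d / 48 - (1 / 4) * ∑ α, S.μ α ^ 2 := by
  have hinv : ∀ x ∈ W, (S.dtdu u x).det * (Matrix.of fun i α => pd α (fun s => u s i) x).det = 1 :=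
    fun x hx => by rw [← Matrix.det_mul, dtdu_mul_jacobian hu hx, Matrix.det_one]
  have hτd := hasDerivAt_line (hτ.analytic s hs) fun ε => S.E ε s
  have hτe : ∑ α, S.E α s * pd α τ s = (-(1 / 4) * ∑ α, S.μ α ^ 2) * τ s := by
    rw [euler_eq_sum_canonical hu hs, ← sum_u_H hη hu hs hsU hne, Finset.sum_mul]
    exact Finset.sum_congr rfl fun i _ => by rw [hτ.dlog s hs i]; ring
  rw [hτe] at hτd
  have hline : ∀ᶠ x : ℂ in 𝓝 0, (s + x • fun ε => S.E ε s) ∈ W := by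
    have hc : Continuous fun x : ℂ => s + x • fun ε => S.E ε s := by fun_prop
    exact hc.continuousAt.eventually_mem (hW.mem_nhds (by simpa using hs))
  have h := deriv_log_of_exp_eq (hasDerivAt_line hG fun ε => S.E ε s)
    (z := -(1 / 4) * ∑ α, S.μ α ^ 2)
    (τ := fun x : ℂ => τ (s + x • fun ε => S.E ε s)) (by simpa using hτd) (q := ∑ α, S.q α)
    (J := fun x : ℂ => (Matrix.of fun i α =>
      pd α (fun s => u s i) (s + x • fun ε => S.E ε s)).det)
    (by simpa using hasDerivAt_det_jacobian hW hu hs) (by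
      filter_upwards [hline] with x hx
      rw [← hf _ hx]
      linear_combination -(Complex.exp (G _) ^ 24) * hinv _ hx)
  rw [h, sum_q hη hsU]
  ring

end Canonical

/-- The canonical coordinates are distinct on a dense subset of a canonical chart. -/
theorem exists_distinct_canonical {W O : Set (Fin n → ℂ)} {u : (Fin n → ℂ) → Fin n → ℂ}
    (hu : S.IsCanonical W u) (hO : IsOpen O) (hne : O.Nonempty) (hOW : O ⊆ W) :
    ∃ s ∈ O, ∀ i j, i ≠ j → u s i ≠ u s j := by
  have key : ∀ P : Finset (Fin n × Fin n), ∃ O' ⊆ O, IsOpen O' ∧ O'.Nonempty ∧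
      ∀ s ∈ O', ∀ p ∈ P, p.1 ≠ p.2 → u s p.1 ≠ u s p.2 := by
    intro P
    induction P using Finset.induction_on with
    | empty => exact ⟨O, subset_rfl, hO, hne, by simp⟩
    | insert p P _ ih =>
      obtain ⟨O', hO'O, hO', hne', h⟩ := ih
      by_cases hp : p.1 = p.2
      · refine ⟨O', hO'O, hO', hne', fun s hs p' hp' => ?_⟩
        rcases Finset.mem_insert.mp hp' with rfl | hp'
        · exact fun h => absurd hp h
        · exact h s hs p' hp'
      have hcont : ContinuousOn (fun s => u s p.1 - u s p.2) O' := fun s hs =>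
        ((hu.analytic p.1 s (hOW (hO'O hs))).continuousAt.sub
          (hu.analytic p.2 s (hOW (hO'O hs))).continuousAt).continuousWithinAt
      refine ⟨O' ∩ (fun s => u s p.1 - u s p.2) ⁻¹' {0}ᶜ, Set.inter_subset_left.trans hO'O,
        hcont.isOpen_inter_preimage hO' isOpen_compl_singleton, ?_, ?_⟩
      · by_contra hemp
        have heq : ∀ s ∈ O', u s p.1 = u s p.2 := by
          intro s hs
          by_contra hsne
          exact hemp ⟨s, hs, fun h0 => hsne (sub_eq_zero.mp h0)⟩
        -- two equal rows of the Jacobi matrix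
        obtain ⟨s, hs⟩ := hne'
        refine hu.jacobian s (hOW (hO'O hs)) (Matrix.det_zero_of_row_eq hp ?_)
        ext α
        exact pd_congr_on hO' heq hs α
      · rintro s ⟨hs, hs'⟩ p' hp' hne'
        rcases Finset.mem_insert.mp hp' with rfl | hp'
        · exact fun h0 => hs' (sub_eq_zero.mpr h0)
        · exact h s hs p' hp' hne'
  obtain ⟨O', hO'O, _, ⟨s, hs⟩, h⟩ := key Finset.univ
  exact ⟨s, hO'O hs, fun i j hij => h s hs (i, j) (Finset.mem_univ _) hij⟩

/-- The G-function is quasihomogeneous: `E(G) = n d / 48 - ¼ ∑ μ_α²`. -/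
theorem euler_G (hη : ∀ α β : Fin n, S.η α β = if β = Fin.rev α then 1 else 0)
    (hss : S.IsSemisimple) {G : (Fin n → ℂ) → ℂ} (hG : S.IsGFunction G) (ht : t ∈ S.U) :
    ∑ ε, S.E ε t * pd ε G t = n * S.d / 48 - (1 / 4) * ∑ α, S.μ α ^ 2 := by
  by_contra hne
  set c : ℂ := n * S.d / 48 - (1 / 4) * ∑ α, S.μ α ^ 2
  have hcont : ContinuousOn (fun t => ∑ ε, S.E ε t * pd ε G t) S.U := fun s hs => by
    have h1 : ∀ ε, ContinuousAt (pd ε G) s := fun ε =>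
      (analyticAt_pd (hG.analytic s hs) ε).continuousAt
    have h2 : ∀ ε, ContinuousAt (S.E ε) s := fun ε =>
      (((continuous_apply ε).const_mul _).add continuous_const).continuousAt
    exact (tendsto_finsetSum _ fun ε _ => (h2 ε).mul (h1 ε)).mono_left nhdsWithin_le_nhds
  have hO := hcont.isOpen_inter_preimage S.isOpen_U (isOpen_compl_singleton (x := c))
  obtain ⟨t', ht'O, ht'U, ht's⟩ := mem_closure_iff.mp (hss ht) _ hO ⟨ht, hne⟩
  obtain ⟨W, hW, ht'W, hWU, u, τ, hu, hτ, hf⟩ := hG.formula t' ht'U ht's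
  obtain ⟨s, ⟨hsW, hsU, hsne⟩, hdist⟩ := exists_distinct_canonical hu (hW.inter hO)
    ⟨t', ht'W, ht'O⟩ Set.inter_subset_left
  exact hsne (euler_G_of_canonical hη (hG.analytic s hsU) hW hu hτ hf hsW hsU hdist)

end WDVVSolution
end OneLoop

/-! ### The explicit bracket of the last coordinate with itself -/

namespace OneLoop

namespace WDVVSolution

variable {n : ℕ} [NeZero n] {S : WDVVSolution n} {t : Fin n → ℂ}

section LastIndex

variable (hη : ∀ α β : Fin n, S.η α β = if β = Fin.rev α then 1 else 0)
include hη

theorem η_inv_last (σ : Fin n) : S.η⁻¹ S.last σ = if σ = 0 then 1 else 0 := by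
  simp [η_inv_apply hη, last]

theorem c1_last (ht : t ∈ S.U) (β γ : Fin n) : S.c1 S.last [β, γ] t = S.η β γ := by
  rw [c1_eq hη, last, Fin.rev_rev, S.unit t ht]

theorem c1_last_eq_zero (ht : t ∈ S.U) (α β γ : Fin n) (l : List (Fin n)) :
    S.c1 S.last (α :: β :: γ :: l) t = 0 := by
  rw [c1_eq hη, last, Fin.rev_rev, S.pds_unit ht]

theorem c1_zero (ht : t ∈ S.U) (α β : Fin n) :
    S.c1 α [0, β] t = if α = β then 1 else 0 := by
  rw [c1_eq hη, S.pds_F_perm ht (List.Perm.swap 0 (Fin.rev α) [β]), S.unit t ht, hη, Fin.rev_rev]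
  simp only [eq_comm]

theorem c2_last (ht : t ∈ S.U) (β γ : Fin n) :
    S.c2 S.last β [γ] t = if β = γ then 1 else 0 := by
  rw [c2_eq hη, last, Fin.rev_rev, S.unit t ht, hη, Fin.rev_rev]
  simp only [eq_comm]

theorem c2_last_right (ht : t ∈ S.U) (β γ : Fin n) :
    S.c2 β S.last [γ] t = if β = γ then 1 else 0 := by
  rw [c2_eq hη, S.pds_F_perm ht (List.Perm.swap (Fin.rev S.last) (Fin.rev β) [γ]), ← c2_eq hη,
    c2_last hη ht]

theorem c2_last_eq_zero (ht : t ∈ S.U) (β γ δ : Fin n) (l : List (Fin n)) :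
    S.c2 S.last β (γ :: δ :: l) t = 0 := by
  rw [c2_eq hη, last, Fin.rev_rev, S.pds_unit ht]

theorem c2_last_right_eq_zero (ht : t ∈ S.U) (β γ δ : Fin n) (l : List (Fin n)) :
    S.c2 β S.last (γ :: δ :: l) t = 0 := by
  rw [c2_eq hη, S.pds_F_perm ht (List.Perm.swap (Fin.rev S.last) (Fin.rev β) (γ :: δ :: l)),
    ← c2_eq hη, c2_last_eq_zero hη ht]

theorem g_last (ht : t ∈ S.U) (β : Fin n) : S.g S.last β t = S.E β t := by
  simp [g, c2_last hη ht]

theorem g_last_right (ht : t ∈ S.U) (β : Fin n) : S.g β S.last t = S.E β t := by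
  simp [g, c2_last_right hη ht]

theorem r_last (hd : S.d ≠ 1) (ht : t ∈ S.U) : S.r S.last = 0 := by
  by_contra h
  exact hd (by rw [← q_last hη ht, S.r_normal _ h])

theorem bracket0_last (v : ℝ → Fin n → ℂ) (hv : ∀ X, v X ∈ S.U) (β : Fin n) (ψ : ℝ → ℂ)
    (X : ℝ) : S.bracket0 v S.last β ψ X = S.E β (v X) * deriv ψ X +
      ((1 + S.d) / 2 - S.q β) * deriv (fun Y => v Y β) X * ψ X := by
  simp [bracket0, mulX, delta, g_last hη (hv X), Γ, c2_last hη (hv X), jet]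

/-- The action of the Hamiltonian vector field of `t^n` on the coordinates. -/
theorem bracket0_last_right (v : ℝ → Fin n → ℂ) (hv : ∀ X, v X ∈ S.U) (α : Fin n) (ψ : ℝ → ℂ)
    (X : ℝ) : S.bracket0 v α S.last ψ X = S.E α (v X) * deriv ψ X +
      (1 - S.d) / 2 * deriv (fun Y => v Y α) X * ψ X := by
  simp only [bracket0, mulX, delta, Pi.add_apply, g_last_right hη (hv X), Γ,
    c2_last_right hη (hv X), jet, q_last hη (hv X)]
  simp
  ring_nf
  simp

/-! ### The one-loop coefficients with both indices equal to `n` -/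

theorem analyticAt_w3 (ht : t ∈ S.U) (α β γ : Fin n) : AnalyticAt ℂ (S.w3 α β γ) t := by
  have h : S.w3 α β γ = ∑ m, ∑ ν, (S.c2 m ν [m, β] * S.c1 α [ν, γ] -
      S.c2 m ν [γ] * S.c1 α [m, ν, β]) := by
    ext s
    simp [w3]
  rw [h]
  simp only [c1_eq hη, c2_eq hη]
  exact Finset.analyticAt_sum _ fun m _ => Finset.analyticAt_sum _ fun ν _ =>
    ((S.analyticAt_pds_F ht _).mul (S.analyticAt_pds_F ht _)).sub
      ((S.analyticAt_pds_F ht _).mul (S.analyticAt_pds_F ht _))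

theorem w3_last (ht : t ∈ S.U) (β γ : Fin n) :
    S.w3 S.last β γ t = ∑ m, S.c2 m (Fin.rev γ) [m, β] t := by
  unfold w3
  refine Finset.sum_congr rfl fun m _ => ?_
  simp only [c1_last hη ht, c1_last_eq_zero hη ht, hη]
  have h : ∀ ν : Fin n, (γ = Fin.rev ν) = (ν = Fin.rev γ) := fun ν => by
    rw [eq_iff_iff]
    constructor <;> rintro rfl <;> simp
  simp [h]

theorem w3_last_zero_right (ht : t ∈ S.U) (γ : Fin n) : S.w3 S.last γ 0 t = 0 := by
  rw [w3_last hη ht]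
  exact Finset.sum_eq_zero fun m _ => c2_last_right_eq_zero hη ht m m γ []

theorem pd_zero_w3_last (ht : t ∈ S.U) (β γ : Fin n) : pd 0 (S.w3 S.last β γ) t = 0 := by
  rw [pd_congr_on (g := fun t => ∑ m, S.c2 m (Fin.rev γ) [m, β] t) S.isOpen_U
    (fun s hs => w3_last hη hs β γ) ht]
  simp only [c2_eq hη]
  rw [pd_sum _ fun m _ => (S.analyticAt_pds_F ht _).differentiableAt]
  exact Finset.sum_eq_zero fun m _ => S.pds_unit ht _ _ _ [β]

theorem hCoef_last (ht : t ∈ S.U) : S.hCoef S.last S.last t = n * (3 - S.d) / 24 := by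
  have h1 : ∀ m ν, pd ν (fun s => S.g m ν s * S.c2 S.last S.last [m] s) t =
      if S.last = m then 1 - S.q ν else 0 := by
    intro m ν
    rw [pd_congr_on (g := fun s => if S.last = m then S.E ν s else 0) S.isOpen_U
      (fun s hs => by
        dsimp only
        rw [c2_last hη hs]
        split_ifs with h
        · rw [← h, g_last hη hs, mul_one]
        · rw [mul_zero]) ht]
    split_ifs
    · have h2 : ∀ s : Fin n → ℂ, S.E ν s = (1 - S.q ν) * s ν + S.r ν := fun s => rfl
      simp only [h2]
      rw [pd_add (by fun_prop) (by fun_prop), pd_mul (by fun_prop) (by fun_prop), pd_coord,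
        pd_const, pd_const]
      simp
    · rw [pd_const]
  unfold hCoef
  simp only [h1, c2_last hη ht]
  rw [Finset.sum_comm (γ := Fin n)]
  simp only [mul_ite, mul_one, mul_zero, Finset.sum_ite_eq, Finset.mem_univ, if_true,
    Finset.sum_sub_distrib, sum_q hη ht]
  rw [Finset.sum_comm (γ := Fin n)]
  simp [c2_last hη ht]
  ring

theorem pCoef_last (ht : t ∈ S.U) (γ : Fin n) : S.pCoef S.last S.last γ t = 0 := by
  simp [pCoef, c2_last_eq_zero hη ht]

theorem pd_hCoef_last (ht : t ∈ S.U) (γ : Fin n) : pd γ (S.hCoef S.last S.last) t = 0 := by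
  rw [pd_congr_on S.isOpen_U (fun s hs => hCoef_last hη hs) ht, pd_const]

theorem rCoef_last (ht : t ∈ S.U) (γ : Fin n) : S.rCoef S.last S.last γ t = 0 := by
  unfold rCoef
  rw [pd_hCoef_last hη ht]
  ring

theorem fCoef_last (ht : t ∈ S.U) (γ : Fin n) : S.fCoef S.last S.last γ t = 0 := by
  simp [fCoef, rCoef_last hη ht, pCoef_last hη ht, pd_hCoef_last hη ht]

theorem bCoef_last (ht : t ∈ S.U) (γ m : Fin n) : S.bCoef S.last S.last γ m t = 0 := by
  have h0 : ∀ γ m, pd γ (S.w3 S.last m 0) t = 0 := fun γ m => by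
    rw [pd_congr_on (g := fun _ => 0) S.isOpen_U (fun s hs => w3_last_zero_right hη hs m) ht,
      pd_const]
  simp [bCoef, η_inv_last hη, h0, pd_zero_w3_last hη ht, c2_last_eq_zero hη ht]

theorem qCoef_last (ht : t ∈ S.U) (γ m : Fin n) : S.qCoef S.last S.last γ m t = 0 := by
  have h1 : ∀ γ m, pd γ (S.rCoef S.last S.last m) t = 0 := fun γ m => by
    rw [pd_congr_on (g := fun _ => 0) S.isOpen_U (fun s hs => rCoef_last hη hs m) ht, pd_const]
  have h2 : pd m (fun s => S.pCoef S.last S.last γ s + S.pCoef S.last S.last γ s) t = 0 := by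
    rw [pd_congr_on (g := fun _ => 0) S.isOpen_U
      (fun s hs => by simp [pCoef_last hη hs]) ht, pd_const]
  have h3 : pds [m, γ] (S.hCoef S.last S.last) t = 0 :=
    pds_const_on S.isOpen_U (fun s hs => hCoef_last hη hs) (by simp) ht
  simp [qCoef, bCoef_last hη ht, h1, h2, h3]

theorem aCoef_last (ht : t ∈ S.U) (γ m ν : Fin n) : S.aCoef S.last S.last γ m ν t = 0 := by
  have h1 : ∀ α β γ, pds [α, β] (S.w3 S.last γ 0) t = 0 := fun α β γ =>
    pds_const_on S.isOpen_U (fun s hs => w3_last_zero_right hη hs γ) (by simp) ht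
  have h3 : ∀ α β γ, pds [0, α] (S.w3 S.last β γ) t = 0 := fun α β γ => by
    rw [pds_perm S.isOpen_U (fun s hs => analyticAt_w3 hη hs S.last β γ)
      (List.Perm.swap α 0 []) ht]
    change pd α (pd 0 (S.w3 S.last β γ)) t = 0
    rw [pd_congr_on (g := fun _ => 0) S.isOpen_U (fun s hs => pd_zero_w3_last hη hs β γ) ht,
      pd_const]
  simp [aCoef, η_inv_last hη, h1, h3, c2_last_eq_zero hη ht]

theorem correction'_last (v : ℝ → Fin n → ℂ) (hv : ∀ X, v X ∈ S.U) (ψ : ℝ → ℂ) (X : ℝ) :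
    S.correction' v S.last S.last ψ X = n * (3 - S.d) / 24 * iteratedDeriv 3 ψ X := by
  simp [correction', mulX, delta, hCoef_last hη (hv X), rCoef_last hη (hv X),
    fCoef_last hη (hv X), qCoef_last hη (hv X), bCoef_last hη (hv X), aCoef_last hη (hv X),
    pCoef_last hη (hv X)]

variable {G : (Fin n → ℂ) → ℂ}

theorem qG_last (v : ℝ → Fin n → ℂ) (hv : ∀ X, v X ∈ S.U) (X : ℝ) :
    S.qG G v S.last S.last X = 0 := by
  have h1 : ∀ m ν, (∑ σ, ∑ ρ, pds [σ, ρ] G (v X) * S.c2 S.last σ [m] (v X) *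
      S.c2 S.last ρ [ν] (v X)) = pds [m, ν] G (v X) := by
    intro m ν
    simp [c2_last hη (hv X)]
  have h2 : ∀ m ν, (∑ σ, ∑ ρ, pds [σ, ν] G (v X) * S.c2 S.last σ [ρ] (v X) *
      S.c2 ρ S.last [m] (v X)) = pds [m, ν] G (v X) := by
    intro m ν
    simp [c2_last hη (hv X), c2_last_right hη (hv X)]
  simp [qG, h1, h2, c2_last_eq_zero hη (hv X)]

theorem aG_last (hss : S.IsSemisimple) (hG : S.IsGFunction G) (ht : t ∈ S.U) :
    S.aG G S.last S.last t = 2 * (n * S.d / 48 - (1 / 4) * ∑ α, S.μ α ^ 2) := by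
  rw [← euler_G hη hss hG ht]
  simp [aG, c2_last hη ht, g_last_right hη ht]

theorem bG_last (hss : S.IsSemisimple) (hG : S.IsGFunction G) (v : ℝ → Fin n → ℂ)
    (hv : ∀ X, v X ∈ S.U) : S.bG G v S.last S.last = fun _ => 0 := by
  ext X
  simp [bG, aG_last hη hss hG (hv _)]

theorem correction''_last (hss : S.IsSemisimple) (hG : S.IsGFunction G) (v : ℝ → Fin n → ℂ)
    (hv : ∀ X, v X ∈ S.U) (ψ : ℝ → ℂ) (X : ℝ) : S.correction'' G v S.last S.last ψ X =
      2 * (n * S.d / 48 - (1 / 4) * ∑ α, S.μ α ^ 2) * iteratedDeriv 3 ψ X := by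
  have hq : S.qG G v S.last S.last = fun _ => 0 := funext fun X => qG_last hη v hv X
  simp [correction'', mulX, delta, eG, aG_last hη hss hG (hv _), bG_last hη hss hG v hv, hq,
    iteratedDeriv_const]

/-- The Virasoro bracket for the explicit deformed bracket. -/
theorem virasoro_bracket2 (hd : S.d ≠ 1) (hss : S.IsSemisimple) (hG : S.IsGFunction G) (ε : ℂ)
    (v : ℝ → Fin n → ℂ) (hv : ∀ X, v X ∈ S.U) (hvs : ContDiff ℝ ∞ v) :
    DistribEq ((2 / (1 - S.d)) ^ 2 • S.bracket2 G ε v S.last S.last)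
      (virasoro (fun X => 2 / (1 - S.d) * v X S.last) S.centralCharge ε) := by
  intro ψ hψ X
  have hd' : 1 - S.d ≠ 0 := sub_ne_zero.mpr hd.symm
  have hv1 : DifferentiableAt ℝ (fun Y => v Y S.last) X :=
    (contDiff_pi.mp hvs S.last).differentiable (by simp) X
  have hψ1 : DifferentiableAt ℝ ψ X := hψ.differentiable (by simp) X
  have hL : deriv (fun Y => 2 / (1 - S.d) * v Y S.last * ψ Y) X =
      2 / (1 - S.d) * (deriv (fun Y => v Y S.last) X * ψ X + v X S.last * deriv ψ X) := by
    rw [deriv_fun_mul (hv1.const_mul _) hψ1, deriv_const_mul _ hv1]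
    ring
  simp only [bracket2, virasoro, mulX, mulY, delta, Pi.smul_apply, Pi.add_apply, smul_eq_mul,
    correction'_last hη v hv, correction''_last hη hss hG v hv, bracket0_last hη v hv, E,
    r_last hη hd (hv X), q_last hη (hv X), iteratedDeriv_one, hL, centralCharge]
  field_simp
  ring

end LastIndex

end WDVVSolution
end OneLoop

namespace OneLoop

/-! ### Local linear operators on smooth functions -/

/-- An operator on functions of one real variable that is local and linear on functions smooth
on the set `I`, and preserves them. Differential operators with smooth coefficients are the
example. -/
structure IsLocalLinear (I : Set ℝ) (L : (ℝ → ℂ) → ℝ → ℂ) : Prop where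
  smooth : ∀ f, ContDiffOn ℝ ∞ f I → ContDiffOn ℝ ∞ (L f) I
  congr : ∀ f g, Set.EqOn f g I → Set.EqOn (L f) (L g) I
  add : ∀ f g, ContDiffOn ℝ ∞ f I → ContDiffOn ℝ ∞ g I →
    ∀ ⦃X⦄, X ∈ I → L (fun Y => f Y + g Y) X = L f X + L g X
  smul : ∀ (c : ℂ) (f), ContDiffOn ℝ ∞ f I →
    ∀ ⦃X⦄, X ∈ I → L (fun Y => c * f Y) X = c * L f X

/-- The formal adjoint `-∂_X` of the derivative. -/
noncomputable def negDeriv (f : ℝ → ℂ) : ℝ → ℂ := fun Y => -deriv f Y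

section LocalLinear

variable {I : Set ℝ} {L K : (ℝ → ℂ) → ℝ → ℂ} {f g : ℝ → ℂ}

theorem differentiableAt_of_smoothOn (hI : IsOpen I) (hf : ContDiffOn ℝ ∞ f I) {X : ℝ}
    (hX : X ∈ I) : DifferentiableAt ℝ f X :=
  (hf.contDiffAt (hI.mem_nhds hX)).differentiableAt (by simp)

theorem deriv_eqOn (hI : IsOpen I) (h : Set.EqOn f g I) : Set.EqOn (deriv f) (deriv g) I :=
  fun _ hX => (h.eventuallyEq_of_mem (hI.mem_nhds hX)).deriv_eq

theorem contDiffOn_deriv (hI : IsOpen I) (hf : ContDiffOn ℝ ∞ f I) :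
    ContDiffOn ℝ ∞ (deriv f) I :=
  hf.deriv_of_isOpen hI (by simp)

theorem isLocalLinear_deriv (hI : IsOpen I) : IsLocalLinear I deriv where
  smooth _ hf := contDiffOn_deriv hI hf
  congr _ _ h := deriv_eqOn hI h
  add _ _ hf hg _ hX := deriv_fun_add (differentiableAt_of_smoothOn hI hf hX)
    (differentiableAt_of_smoothOn hI hg hX)
  smul c _ hf _ hX := deriv_const_mul c (differentiableAt_of_smoothOn hI hf hX)

theorem isLocalLinear_negDeriv (hI : IsOpen I) : IsLocalLinear I negDeriv where
  smooth _ hf := (contDiffOn_deriv hI hf).neg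
  congr _ _ h _ hX := congrArg Neg.neg (deriv_eqOn hI h hX)
  add _ _ hf hg _ hX := by
    simp only [negDeriv, (isLocalLinear_deriv hI).add _ _ hf hg hX]
    ring
  smul c _ hf _ hX := by
    simp only [negDeriv, (isLocalLinear_deriv hI).smul c _ hf hX]
    ring

theorem IsLocalLinear.comp (hL : IsLocalLinear I L) (hK : IsLocalLinear I K) :
    IsLocalLinear I fun f => L (K f) where
  smooth _ hf := hL.smooth _ (hK.smooth _ hf)
  congr _ _ h := hL.congr _ _ (hK.congr _ _ h)
  add f g hf hg _ hX := (hL.congr _ _ (fun _ hY => hK.add f g hf hg hY) hX).trans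
    (hL.add _ _ (hK.smooth _ hf) (hK.smooth _ hg) hX)
  smul c f hf _ hX := (hL.congr _ _ (fun _ hY => hK.smul c f hf hY) hX).trans
    (hL.smul c _ (hK.smooth _ hf) hX)

theorem IsLocalLinear.iterate (hL : IsLocalLinear I L) (k : ℕ) : IsLocalLinear I (L^[k]) := by
  induction k with
  | zero => exact ⟨fun _ h => h, fun _ _ h => h, fun _ _ _ _ _ _ => rfl, fun _ _ _ _ _ => rfl⟩
  | succ k ih => exact ih.comp hL

/-- A first order differential operator with smooth coefficients. -/
theorem isLocalLinear_firstOrder (hI : IsOpen I) {a b : ℝ → ℂ} (ha : ContDiffOn ℝ ∞ a I)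
    (hb : ContDiffOn ℝ ∞ b I) : IsLocalLinear I fun f Y => a Y * deriv f Y + b Y * f Y where
  smooth _ hf := (ha.mul (contDiffOn_deriv hI hf)).add (hb.mul hf)
  congr _ _ h Y hY := by simp only [h hY, deriv_eqOn hI h hY]
  add _ _ hf hg Y hY := by
    simp only [(isLocalLinear_deriv hI).add _ _ hf hg hY]
    ring
  smul c _ hf Y hY := by
    simp only [(isLocalLinear_deriv hI).smul c _ hf hY]
    ring

theorem IsLocalLinear.zero (hL : IsLocalLinear I L) : Set.EqOn (L fun _ => 0) (fun _ => 0) I := by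
  intro X hX
  have h := hL.smul 0 (fun _ => 0) contDiffOn_const hX
  simpa using h

theorem IsLocalLinear.sum (hL : IsLocalLinear I L) {ι : Type*} (s : Finset ι) (f : ι → ℝ → ℂ)
    (hf : ∀ i, ContDiffOn ℝ ∞ (f i) I) :
    Set.EqOn (L fun Y => ∑ i ∈ s, f i Y) (fun Y => ∑ i ∈ s, L (f i) Y) I := by
  induction s using Finset.cons_induction with
  | empty => simpa using hL.zero
  | cons a s ha ih =>
    intro X hX
    simp only [Finset.sum_cons]
    rw [hL.add _ _ (hf a) (ContDiffOn.sum fun i _ => hf i) hX, ih hX]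

end LocalLinear

/-! ### Jets and total derivatives -/

section Jets

variable {m n : ℕ}

/-- Forgetting the highest derivative. -/
noncomputable def jetInit : Jets (m + 1) n →L[ℂ] Jets m n :=
  ContinuousLinearMap.pi fun i => ContinuousLinearMap.proj i.castSucc

/-- Forgetting the value: the jet of the derivative. -/
noncomputable def jetTail : Jets (m + 1) n →L[ℂ] Jets m n :=
  ContinuousLinearMap.pi fun i => ContinuousLinearMap.proj i.succ

@[simp] theorem jetInit_apply (j : Jets (m + 1) n) (i : Fin m) : jetInit j i = j i.castSucc := rfl

@[simp] theorem jetTail_apply (j : Jets (m + 1) n) (i : Fin m) : jetTail j i = j i.succ := rfl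

theorem jetInit_jet (v : ℝ → Fin n → ℂ) (X : ℝ) : jetInit (jet (m + 1) v X) = jet m v X := rfl

theorem jetInit_single_castSucc (i : Fin m) (x : Fin n → ℂ) :
    jetInit (Pi.single i.castSucc x : Jets (m + 1) n) = Pi.single i x := by
  ext k γ
  by_cases h : k = i
  · subst h; simp
  · simp [h]

theorem jetInit_single_last (x : Fin n → ℂ) :
    jetInit (Pi.single (Fin.last m) x : Jets (m + 1) n) = 0 := by
  ext k γ
  simp [(Fin.castSucc_lt_last k).ne]

theorem jetTail_single_succ (i : Fin m) (x : Fin n → ℂ) :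
    jetTail (Pi.single i.succ x : Jets (m + 1) n) = Pi.single i x := by
  ext k γ
  by_cases h : k = i
  · subst h; simp
  · simp [h]

theorem jetTail_single_zero (x : Fin n → ℂ) :
    jetTail (Pi.single 0 x : Jets (m + 1) n) = 0 := by
  ext k γ
  simp

theorem clm_jets_eq_sum (L : Jets m n →L[ℂ] ℂ) (j : Jets m n) :
    L j = ∑ k, ∑ γ, L (Pi.single k (Pi.single γ 1)) * j k γ := by
  have h : j = ∑ k, ∑ γ, j k γ • (Pi.single k (Pi.single γ 1) : Jets m n) := by
    ext k γ
    simp [Finset.sum_apply, Pi.single_apply, apply_ite (fun f : Fin n → ℂ => f γ)]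
  conv_lhs => rw [h]
  simp [map_sum, mul_comm]

theorem fderiv_eq_sum_jpd (a : Jets m n → ℂ) (j h : Jets m n) :
    fderiv ℂ a j h = ∑ k, ∑ γ, jpd k γ a j * h k γ :=
  clm_jets_eq_sum _ h

theorem totalD_eq_fderiv (a : Jets m n → ℂ) (j : Jets (m + 1) n) :
    totalD a j = fderiv ℂ a (jetInit j) (jetTail j) := by
  rw [fderiv_eq_sum_jpd]
  rfl

theorem analyticAt_jpd {a : Jets m n → ℂ} {j : Jets m n} (ha : AnalyticAt ℂ a j) (k : Fin m)
    (γ : Fin n) : AnalyticAt ℂ (jpd k γ a) j :=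
  ((ContinuousLinearMap.apply ℂ ℂ (Pi.single k (Pi.single γ 1) : Jets m n)).analyticAt _).comp
    ha.fderiv

theorem analyticAt_jetEntry (k : Fin m) (γ : Fin n) (j : Jets m n) :
    AnalyticAt ℂ (fun j : Jets m n => j k γ) j :=
  ((ContinuousLinearMap.proj (R := ℂ) (φ := fun _ : Fin n => ℂ) γ).comp
    (ContinuousLinearMap.proj (R := ℂ) (φ := fun _ : Fin m => Fin n → ℂ) k)).analyticAt j

theorem analyticAt_totalD {a : Jets m n → ℂ} {j : Jets (m + 1) n}
    (ha : AnalyticAt ℂ a (jetInit j)) : AnalyticAt ℂ (totalD a) j := by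
  have h : totalD a = ∑ k, ∑ γ,
      (fun j => jpd k γ a (jetInit j)) * fun j : Jets (m + 1) n => j k.succ γ := by
    ext j
    simp only [totalD, Finset.sum_apply, Pi.mul_apply]
    rfl
  rw [h]
  exact Finset.analyticAt_sum _ fun k _ => Finset.analyticAt_sum _ fun γ _ =>
    ((analyticAt_jpd ha k γ).comp (jetInit.analyticAt j)).mul (analyticAt_jetEntry _ _ _)

theorem fderiv_totalD {a : Jets m n → ℂ} {j : Jets (m + 1) n} (ha : AnalyticAt ℂ a (jetInit j))
    (h : Jets (m + 1) n) : fderiv ℂ (totalD a) j h =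
      fderiv ℂ (fderiv ℂ a) (jetInit j) (jetInit h) (jetTail j) +
        fderiv ℂ a (jetInit j) (jetTail h) := by
  have h1 : HasFDerivAt (fun j => fderiv ℂ a (jetInit j)) _ j :=
    ha.fderiv.differentiableAt.hasFDerivAt.comp j jetInit.hasFDerivAt
  have h2 := h1.clm_apply (jetTail (m := m) (n := n)).hasFDerivAt
  have h3 : totalD a = fun j => fderiv ℂ a (jetInit j) (jetTail j) :=
    funext (totalD_eq_fderiv a)
  rw [h3, h2.fderiv]
  simp [add_comm]

/-- The product rule for the complex differential of `a`, evaluated along real curves of base points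
and of directions. -/
theorem hasDerivAt_fderiv_curve {a : Jets m n → ℂ} {p h : ℝ → Jets m n} {p' h' : Jets m n} {X : ℝ}
    (ha : AnalyticAt ℂ a (p X)) (hp : HasDerivAt p p' X) (hh : HasDerivAt h h' X) :
    HasDerivAt (fun Y => fderiv ℂ a (p Y) (h Y))
      (fderiv ℂ (fderiv ℂ a) (p X) p' (h X) + fderiv ℂ a (p X) h') X := by
  have h1 : HasFDerivAt (fun q : Jets m n × Jets m n => fderiv ℂ a q.1) _ (p X, h X) :=
    HasFDerivAt.comp (g := fderiv ℂ a) (p X, h X) ha.fderiv.differentiableAt.hasFDerivAt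
      hasFDerivAt_fst
  have h2 := (h1.clm_apply hasFDerivAt_snd).restrictScalars ℝ
  have h3 := HasFDerivAt.comp_hasDerivAt X h2 (hp.prodMk hh)
  convert! h3 using 1
  simp [add_comm]

variable {I : Set ℝ} {v ξ : ℝ → Fin n → ℂ}

theorem contDiffOn_jet (hI : IsOpen I) (hv : ∀ γ, ContDiffOn ℝ ∞ (fun Y => v Y γ) I) :
    ContDiffOn ℝ ∞ (jet m v) I := by
  refine contDiffOn_pi.mpr fun k => contDiffOn_pi.mpr fun γ => ?_
  simp only [jet, iteratedDeriv_eq_iterate]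
  exact ((isLocalLinear_deriv hI).iterate k).smooth _ (hv γ)

theorem hasDerivAt_jet (hI : IsOpen I) (hv : ∀ γ, ContDiffOn ℝ ∞ (fun Y => v Y γ) I) {X : ℝ}
    (hX : X ∈ I) : HasDerivAt (jet m v) (jetTail (jet (m + 1) v X)) X := by
  refine hasDerivAt_pi.mpr fun k => hasDerivAt_pi.mpr fun γ => ?_
  simp only [jetTail_apply, jet, Fin.val_succ, iteratedDeriv_succ]
  simp only [iteratedDeriv_eq_iterate]
  exact (differentiableAt_of_smoothOn hI
    (((isLocalLinear_deriv hI).iterate k).smooth _ (hv γ)) hX).hasDerivAt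

theorem contDiffOn_comp_jet (hI : IsOpen I) (hv : ∀ γ, ContDiffOn ℝ ∞ (fun Y => v Y γ) I)
    {a : Jets m n → ℂ} (ha : ∀ X ∈ I, AnalyticAt ℂ a (jet m v X)) :
    ContDiffOn ℝ ∞ (fun Y => a (jet m v Y)) I := by
  intro X hX
  have h1 : ContDiffAt ℝ ∞ a (jet m v X) := (ha X hX).contDiffAt.restrict_scalars ℝ
  exact (h1.comp X ((contDiffOn_jet hI hv).contDiffAt (hI.mem_nhds hX))).contDiffWithinAt

/-- The total derivative along a curve is the derivative of the composite. -/
theorem totalD_jet (hI : IsOpen I) (hv : ∀ γ, ContDiffOn ℝ ∞ (fun Y => v Y γ) I)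
    {a : Jets m n → ℂ} {X : ℝ} (hX : X ∈ I) (ha : AnalyticAt ℂ a (jet m v X)) :
    totalD a (jet (m + 1) v X) = deriv (fun Y => a (jet m v Y)) X := by
  rw [totalD_eq_fderiv, jetInit_jet]
  exact (HasFDerivAt.comp_hasDerivAt X (ha.differentiableAt.hasFDerivAt.restrictScalars ℝ)
    (hasDerivAt_jet hI hv hX)).deriv.symm

theorem fderiv_fderiv_symm {a : Jets m n → ℂ} {j : Jets m n} (ha : AnalyticAt ℂ a j)
    (x y : Jets m n) : fderiv ℂ (fderiv ℂ a) j x y = fderiv ℂ (fderiv ℂ a) j y x :=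
  (ha.contDiffAt.isSymmSndFDerivAt (n := ω) (by simp)).eq _ _

/-- The variation of a local density commutes with the total derivative. -/
theorem fderiv_totalD_jet (hI : IsOpen I) (hv : ∀ γ, ContDiffOn ℝ ∞ (fun Y => v Y γ) I)
    (hξ : ∀ γ, ContDiffOn ℝ ∞ (fun Y => ξ Y γ) I) {a : Jets m n → ℂ} {X : ℝ} (hX : X ∈ I)
    (ha : AnalyticAt ℂ a (jet m v X)) :
    fderiv ℂ (totalD a) (jet (m + 1) v X) (jet (m + 1) ξ X) =
      deriv (fun Y => fderiv ℂ a (jet m v Y) (jet m ξ Y)) X := by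
  rw [fderiv_totalD ha,
    (hasDerivAt_fderiv_curve ha (hasDerivAt_jet hI hv hX) (hasDerivAt_jet hI hξ hX)).deriv,
    fderiv_fderiv_symm ha]
  rfl

/-- The adjoint of the Fréchet derivative of a local density `a` along the curve `v`:
`ψ ↦ ∑_l (-∂_X)^l (∂a/∂v^{δ,(l)} ψ)`. For `ψ = 1` this is the variational derivative. -/
noncomputable def adjointVariation (a : Jets m n → ℂ) (v : ℝ → Fin n → ℂ) (δ : Fin n) (ψ : ℝ → ℂ) :
    ℝ → ℂ :=
  fun Z => ∑ l : Fin m, negDeriv^[l] (fun Y => jpd l δ a (jet m v Y) * ψ Y) Z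

theorem contDiffOn_jpd_jet (hI : IsOpen I) (hv : ∀ γ, ContDiffOn ℝ ∞ (fun Y => v Y γ) I)
    {a : Jets m n → ℂ} (ha : ∀ X ∈ I, AnalyticAt ℂ a (jet m v X)) (l : Fin m) (δ : Fin n) :
    ContDiffOn ℝ ∞ (fun Y => jpd l δ a (jet m v Y)) I :=
  contDiffOn_comp_jet hI hv fun X hX => analyticAt_jpd (ha X hX) l δ

/-- Adjoint form of the commutation of the variation with the total derivative: differentiating
the density differentiates the argument, with a sign. -/
theorem adjointVariation_totalD (hI : IsOpen I) (hv : ∀ γ, ContDiffOn ℝ ∞ (fun Y => v Y γ) I)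
    {a : Jets m n → ℂ} (ha : ∀ X ∈ I, AnalyticAt ℂ a (jet m v X)) (δ : Fin n) {ψ : ℝ → ℂ}
    (hψ : ContDiffOn ℝ ∞ ψ I) :
    Set.EqOn (adjointVariation (totalD a) v δ ψ) (adjointVariation a v δ (negDeriv ψ)) I := by
  intro Z hZ
  have hN := fun l : ℕ => (isLocalLinear_negDeriv hI).iterate l
  set b : Fin m → ℝ → ℂ := fun i Y => jpd i δ a (jet m v Y) with hb
  have hbs : ∀ i, ContDiffOn ℝ ∞ (b i) I := fun i => contDiffOn_jpd_jet hI hv ha i δ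
  -- the two contributions to `∂(∂_X a)/∂v^{δ,(l)}`
  set p : Fin (m + 1) → ℝ → ℂ := fun l Y => fderiv ℂ (fderiv ℂ a) (jet m v Y)
    (jetInit (Pi.single l (Pi.single δ 1))) (jetTail (jet (m + 1) v Y)) with hp
  set s : Fin (m + 1) → ℝ → ℂ := fun l Y => fderiv ℂ a (jet m v Y)
    (jetTail (Pi.single l (Pi.single δ 1))) with hs
  have hp1 : ∀ i : Fin m, Set.EqOn (p i.castSucc) (deriv (b i)) I := by
    intro i Y hY
    have h := hasDerivAt_fderiv_curve (ha Y hY) (hasDerivAt_jet hI hv hY)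
      (hasDerivAt_const Y (Pi.single i (Pi.single δ 1) : Jets m n))
    simp only [map_zero, add_zero] at h
    have h' : deriv (b i) Y = _ := h.deriv
    rw [h', hp]
    simp only [jetInit_single_castSucc]
    exact fderiv_fderiv_symm (ha Y hY) _ _
  have hp2 : p (Fin.last m) = fun _ => 0 := by
    ext Y
    simp [hp, jetInit_single_last]
  have hs1 : ∀ i : Fin m, s i.succ = b i := by
    intro i
    ext Y
    simp only [hs, jetTail_single_succ]
    rfl
  have hs2 : s 0 = fun _ => 0 := by
    ext Y
    simp [hs, jetTail_single_zero]
  have hps : ∀ l, ContDiffOn ℝ ∞ (p l) I := by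
    intro l
    induction l using Fin.lastCases with
    | last => rw [hp2]; exact contDiffOn_const
    | cast i => exact (contDiffOn_deriv hI (hbs i)).congr (hp1 i)
  have hss : ∀ l, ContDiffOn ℝ ∞ (s l) I := by
    intro l
    induction l using Fin.cases with
    | zero => rw [hs2]; exact contDiffOn_const
    | succ i => rw [hs1]; exact hbs i
  have h1 : adjointVariation (totalD a) v δ ψ Z =
      ∑ l : Fin (m + 1), (negDeriv^[l] (fun Y => p l Y * ψ Y) Z +
        negDeriv^[l] (fun Y => s l Y * ψ Y) Z) := by
    refine Finset.sum_congr rfl fun l _ => ?_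
    rw [← (hN l).add _ _ ((hps l).mul hψ) ((hss l).mul hψ) hZ]
    refine (hN l).congr _ _ (fun Y hY => ?_) hZ
    have h2 := fderiv_totalD (j := jet (m + 1) v Y) (ha Y hY) (Pi.single l (Pi.single δ 1))
    have h3 : jpd l δ (totalD a) (jet (m + 1) v Y) = p l Y + s l Y := h2
    rw [h3]
    ring
  rw [h1, Finset.sum_add_distrib, Fin.sum_univ_castSucc, Fin.sum_univ_succ (n := m)]
  simp only [hp2, hs2, hs1, zero_mul, Fin.val_last, (hN _).zero hZ, add_zero, zero_add,
    Fin.val_castSucc, Fin.val_succ]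
  rw [← Finset.sum_add_distrib]
  refine Finset.sum_congr rfl fun i _ => ?_
  rw [Function.iterate_succ_apply, ← (hN i).add _ _ ((hps i.castSucc).mul hψ)
    ((isLocalLinear_negDeriv hI).smooth _ ((hbs i).mul hψ)) hZ]
  refine (hN i).congr _ _ (fun Y hY => ?_) hZ
  have h4 := deriv_fun_mul (differentiableAt_of_smoothOn hI (hbs i) hY)
    (differentiableAt_of_smoothOn hI hψ hY)
  simp only [negDeriv, h4, hp1 i hY]
  simp only [hb]
  ring

/-! ### Brackets of local densities -/

theorem dX_iterate (K : LocalKernel) (k : ℕ) (ψ : ℝ → ℂ) : (dX^[k] K) ψ = deriv^[k] (K ψ) := by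
  induction k generalizing K with
  | zero => rfl
  | succ k ih => rw [Function.iterate_succ_apply, ih, Function.iterate_succ_apply]; rfl

theorem dY_iterate (K : LocalKernel) (l : ℕ) (ψ : ℝ → ℂ) :
    (dY^[l] K) ψ = K (negDeriv^[l] ψ) := by
  induction l generalizing K with
  | zero => rfl
  | succ l ih => rw [Function.iterate_succ_apply, ih, Function.iterate_succ_apply']; rfl

theorem bracketOf_apply (P : Fin n → Fin n → LocalKernel) (v : ℝ → Fin n → ℂ)
    (a b : Jets m n → ℂ) (ψ : ℝ → ℂ) (X : ℝ) : bracketOf P v a b ψ X =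
      ∑ γ, ∑ δ, ∑ k : Fin m, ∑ l : Fin m, jpd k γ a (jet m v X) *
        deriv^[k] (P γ δ (negDeriv^[l] fun Y => jpd l δ b (jet m v Y) * ψ Y)) X := by
  simp only [bracketOf, Finset.sum_apply, mulX, mulY, dX_iterate, dY_iterate]

/-- Expansion of the bracket of an infinitesimally deformed coordinate `v^α + c w` with itself. -/
theorem bracketOf_deformed (hI : IsOpen I) (hv : ∀ γ, ContDiffOn ℝ ∞ (fun Y => v Y γ) I)
    {P : Fin n → Fin n → LocalKernel} (hP : ∀ γ δ, IsLocalLinear I (P γ δ)) {w : Jets (m + 1) n → ℂ}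
    (hw : ∀ Y ∈ I, AnalyticAt ℂ w (jet (m + 1) v Y)) (α : Fin n) (c : ℂ) {ψ : ℝ → ℂ}
    (hψ : ContDiffOn ℝ ∞ ψ I) {X : ℝ} (hX : X ∈ I) :
    bracketOf P v (fun j : Jets (m + 1) n => j 0 α + c * w j) (fun j => j 0 α + c * w j) ψ X =
      P α α ψ X + c * (fderiv ℂ w (jet (m + 1) v X) (jet (m + 1) (fun Y γ => P γ α ψ Y) X) +
        ∑ δ, P α δ (adjointVariation w v δ ψ) X) + c ^ 2 * bracketOf P v w w ψ X := by
  set W : Fin (m + 1) → Fin n → ℝ → ℂ := fun k γ Y => jpd k γ w (jet (m + 1) v Y) with hW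
  have hWs : ∀ k γ, ContDiffOn ℝ ∞ (W k γ) I := fun k γ => contDiffOn_jpd_jet hI hv hw k γ
  set e : Fin (m + 1) → Fin n → ℂ := fun k γ => if γ = α then if k = 0 then 1 else 0 else 0 with he
  have ha : ∀ k γ, ∀ Y ∈ I, jpd k γ (fun j : Jets (m + 1) n => j 0 α + c * w j)
      (jet (m + 1) v Y) = e k γ + c * W k γ Y := by
    intro k γ Y hY
    have h1 : HasFDerivAt (fun j : Jets (m + 1) n => j 0 α)
        ((ContinuousLinearMap.proj (R := ℂ) (φ := fun _ : Fin n => ℂ) α).comp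
          (ContinuousLinearMap.proj (R := ℂ) (φ := fun _ : Fin (m + 1) => Fin n → ℂ) 0))
        (jet (m + 1) v Y) :=
      ((ContinuousLinearMap.proj (R := ℂ) (φ := fun _ : Fin n => ℂ) α).comp
        (ContinuousLinearMap.proj (R := ℂ) (φ := fun _ : Fin (m + 1) => Fin n → ℂ)
          0)).hasFDerivAt
    have h2 := h1.fun_add ((hw Y hY).differentiableAt.hasFDerivAt.const_mul c)
    simp only [jpd, h2.fderiv, hW, he]
    have h3 : (Pi.single k (Pi.single γ 1) : Jets (m + 1) n) 0 α =
        if γ = α then if k = 0 then 1 else 0 else 0 := by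
      by_cases h : k = 0
      · subst h; simp [Pi.single_apply, eq_comm]
      · simp [Ne.symm h, h]
    simp [← h3]
  have hL : ∀ (k l : Fin (m + 1)) (γ δ : Fin n), IsLocalLinear I
      fun f => deriv^[k] (P γ δ (negDeriv^[l] f)) := fun k l γ δ =>
    ((isLocalLinear_deriv hI).iterate k).comp
      ((hP γ δ).comp ((isLocalLinear_negDeriv hI).iterate l))
  have hexp : ∀ (k l : Fin (m + 1)) (γ δ : Fin n),
      deriv^[k] (P γ δ (negDeriv^[l] fun Y => jpd l δ (fun j : Jets (m + 1) n => j 0 α + c * w j)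
        (jet (m + 1) v Y) * ψ Y)) X = e l δ * deriv^[k] (P γ δ (negDeriv^[l] ψ)) X +
          c * deriv^[k] (P γ δ (negDeriv^[l] fun Y => W l δ Y * ψ Y)) X := by
    intro k l γ δ
    rw [← (hL k l γ δ).smul _ _ hψ hX, ← (hL k l γ δ).smul c _ ((hWs l δ).mul hψ) hX,
      ← (hL k l γ δ).add _ _ (contDiffOn_const.mul hψ)
        (contDiffOn_const.mul ((hWs l δ).mul hψ)) hX]
    refine (hL k l γ δ).congr _ _ (fun Y hY => ?_) hX
    simp only [ha l δ Y hY]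
    ring
  have hsplit : bracketOf P v (fun j : Jets (m + 1) n => j 0 α + c * w j)
      (fun j => j 0 α + c * w j) ψ X =
      (∑ γ, ∑ δ, ∑ k : Fin (m + 1), ∑ l : Fin (m + 1),
        e k γ * (e l δ * deriv^[k] (P γ δ (negDeriv^[l] ψ)) X)) +
      c * ((∑ γ, ∑ δ, ∑ k : Fin (m + 1), ∑ l : Fin (m + 1),
        W k γ X * (e l δ * deriv^[k] (P γ δ (negDeriv^[l] ψ)) X)) +
        ∑ γ, ∑ δ, ∑ k : Fin (m + 1), ∑ l : Fin (m + 1),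
          e k γ * deriv^[k] (P γ δ (negDeriv^[l] fun Y => W l δ Y * ψ Y)) X) +
      c ^ 2 * bracketOf P v w w ψ X := by
    simp only [bracketOf_apply, hexp, ha _ _ X hX, Finset.mul_sum, ← Finset.sum_add_distrib]
    refine Finset.sum_congr rfl fun γ _ => Finset.sum_congr rfl fun δ _ =>
      Finset.sum_congr rfl fun k _ => Finset.sum_congr rfl fun l _ => ?_
    simp only [hW]
    ring
  have hsum : ∀ f : Fin n → Fin (m + 1) → ℂ, ∑ γ, ∑ k, e k γ * f γ k = f α 0 := by
    intro f
    simp only [he, ite_mul, one_mul, zero_mul]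
    rw [Finset.sum_eq_single α (fun γ _ h => by simp [h]) (by simp)]
    simp
  have hone : ∑ γ, ∑ δ, ∑ k : Fin (m + 1), ∑ l : Fin (m + 1),
      e k γ * (e l δ * deriv^[k] (P γ δ (negDeriv^[l] ψ)) X) = P α α ψ X := by
    have h1 : ∀ γ, ∑ δ, ∑ k : Fin (m + 1), ∑ l : Fin (m + 1),
        e k γ * (e l δ * deriv^[k] (P γ δ (negDeriv^[l] ψ)) X) =
        ∑ k : Fin (m + 1), e k γ * deriv^[k] (P γ α ψ) X := by
      intro γ
      rw [Finset.sum_comm]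
      refine Finset.sum_congr rfl fun k _ => ?_
      simp only [← Finset.mul_sum]
      rw [hsum fun δ l => deriv^[k] (P γ δ (negDeriv^[l] ψ)) X]
      rfl
    simp only [h1]
    rw [hsum fun γ k => deriv^[k] (P γ α ψ) X]
    rfl
  have htwo : ∑ γ, ∑ δ, ∑ k : Fin (m + 1), ∑ l : Fin (m + 1),
      W k γ X * (e l δ * deriv^[k] (P γ δ (negDeriv^[l] ψ)) X) =
      fderiv ℂ w (jet (m + 1) v X) (jet (m + 1) (fun Y γ => P γ α ψ Y) X) := by
    have h1 : ∀ γ, ∑ δ, ∑ k : Fin (m + 1), ∑ l : Fin (m + 1),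
        W k γ X * (e l δ * deriv^[k] (P γ δ (negDeriv^[l] ψ)) X) =
        ∑ k : Fin (m + 1), W k γ X * deriv^[k] (P γ α ψ) X := by
      intro γ
      rw [Finset.sum_comm]
      refine Finset.sum_congr rfl fun k _ => ?_
      simp only [← Finset.mul_sum]
      rw [hsum fun δ l => deriv^[k] (P γ δ (negDeriv^[l] ψ)) X]
      rfl
    simp only [h1]
    rw [fderiv_eq_sum_jpd, Finset.sum_comm]
    refine Finset.sum_congr rfl fun k _ => Finset.sum_congr rfl fun γ _ => ?_
    simp only [hW, jet, iteratedDeriv_eq_iterate]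
  have hthree : ∑ γ, ∑ δ, ∑ k : Fin (m + 1), ∑ l : Fin (m + 1),
      e k γ * deriv^[k] (P γ δ (negDeriv^[l] fun Y => W l δ Y * ψ Y)) X =
      ∑ δ, P α δ (adjointVariation w v δ ψ) X := by
    have h1 : ∀ γ, ∑ δ, ∑ k : Fin (m + 1), ∑ l : Fin (m + 1),
        e k γ * deriv^[k] (P γ δ (negDeriv^[l] fun Y => W l δ Y * ψ Y)) X =
        ∑ k : Fin (m + 1), e k γ * ∑ δ, ∑ l : Fin (m + 1),
          deriv^[k] (P γ δ (negDeriv^[l] fun Y => W l δ Y * ψ Y)) X := by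
      intro γ
      rw [Finset.sum_comm]
      simp only [← Finset.mul_sum]
    simp only [h1]
    rw [hsum fun γ k => ∑ δ, ∑ l : Fin (m + 1),
          deriv^[k] (P γ δ (negDeriv^[l] fun Y => W l δ Y * ψ Y)) X]
    refine Finset.sum_congr rfl fun δ _ => ?_
    exact ((hP α δ).sum Finset.univ (fun l : Fin (m + 1) => negDeriv^[l] fun Y => W l δ Y * ψ Y)
      (fun l => ((isLocalLinear_negDeriv hI).iterate l).smooth _ ((hWs l δ).mul hψ)) hX).symm
  rw [hsplit, hone, htwo, hthree]

end Jets

end OneLoop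

namespace OneLoop

/-! ### The calculus of the conformal variation -/

/-- Let `F_δ`, `Q_δ` be the partial derivatives, with respect to `x^δ` and to `x^δ_X`, of a first
order density evaluated along the curve `x`, and `Φ` its total derivative. Suppose that its
derivatives along `(E, E_X)` and along `(0, x_X)` are constants `c₀` and `κ`. The first sum is the
variation of the second total derivative of the density along `ξ = E ψ' + k x_X ψ`, the second one
applies the adjoint operator to its adjoint variation. The terms with `∑ E_δ Q_δ`, which are
constrained by no homogeneity, cancel in the sum. -/
theorem variation_add_adjoint {ι : Type*} [Fintype ι] {I : Set ℝ} (hI : IsOpen I)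
    {x E F Q : ι → ℝ → ℂ} {Φ ψ : ℝ → ℂ} {q : ι → ℂ} {c₀ κ k : ℂ}
    (hx : ∀ δ, ContDiffOn ℝ ∞ (x δ) I) (hE : ∀ δ, ContDiffOn ℝ ∞ (E δ) I)
    (hF : ∀ δ, ContDiffOn ℝ ∞ (F δ) I) (hQ : ∀ δ, ContDiffOn ℝ ∞ (Q δ) I)
    (hΦ : ContDiffOn ℝ ∞ Φ I) (hψ : ContDiffOn ℝ ∞ ψ I)
    (hEx : ∀ δ, ∀ Y ∈ I, deriv (E δ) Y = (1 - q δ) * deriv (x δ) Y)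
    (h₀ : ∀ Y ∈ I, ∑ δ, (F δ Y * E δ Y + Q δ Y * ((1 - q δ) * deriv (x δ) Y)) = c₀)
    (hκ : ∀ Y ∈ I, ∑ δ, Q δ Y * deriv (x δ) Y = κ)
    (hΦ' : ∀ Y ∈ I, Φ Y = ∑ δ, (F δ Y * deriv (x δ) Y + Q δ Y * deriv (deriv (x δ)) Y))
    {X : ℝ} (hX : X ∈ I) :
    deriv (deriv fun Y => ∑ δ, (F δ Y * (E δ Y * deriv ψ Y + k * deriv (x δ) Y * ψ Y) +
        Q δ Y * deriv (fun Z => E δ Z * deriv ψ Z + k * deriv (x δ) Z * ψ Z) Y)) X +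
      ∑ δ, (E δ X * deriv (fun Y => F δ Y * deriv (deriv ψ) Y -
          deriv (fun Z => Q δ Z * deriv (deriv ψ) Z) Y) X +
        ((1 - q δ) - k) * deriv (x δ) X * (F δ X * deriv (deriv ψ) X -
          deriv (fun Z => Q δ Z * deriv (deriv ψ) Z) X)) =
      k * (ψ X * deriv (deriv Φ) X + 2 * deriv ψ X * deriv Φ X) +
        2 * (c₀ + k * κ) * deriv (deriv (deriv ψ)) X := by
  have D : ∀ {f : ℝ → ℂ}, ContDiffOn ℝ ∞ f I → ContDiffOn ℝ ∞ (deriv f) I :=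
    fun hf => contDiffOn_deriv hI hf
  have H : ∀ {f : ℝ → ℂ}, ContDiffOn ℝ ∞ f I → ∀ {Y}, Y ∈ I → HasDerivAt f (deriv f Y) Y :=
    fun hf _ hY => (differentiableAt_of_smoothOn hI hf hY).hasDerivAt
  set χ := deriv (deriv ψ) with hχ
  have hχs : ContDiffOn ℝ ∞ χ I := D (D hψ)
  set A : ℝ → ℂ := fun Y => ∑ δ, E δ Y * Q δ Y with hA
  have hAs : ContDiffOn ℝ ∞ A I := ContDiffOn.sum fun δ _ => (hE δ).mul (hQ δ)
  have hAχ : ContDiffOn ℝ ∞ (fun Y => A Y * χ Y) I := hAs.mul hχs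
  set φ : ι → ℝ → ℂ := fun δ Y => F δ Y * χ Y - deriv (fun Z => Q δ Z * χ Z) Y with hφ
  have hφs : ∀ δ, ContDiffOn ℝ ∞ (φ δ) I := fun δ =>
    ((hF δ).mul hχs).sub (D ((hQ δ).mul hχs))
  -- the variation of the density
  have e1 : ∀ Y ∈ I, ∑ δ, (F δ Y * (E δ Y * deriv ψ Y + k * deriv (x δ) Y * ψ Y) +
        Q δ Y * deriv (fun Z => E δ Z * deriv ψ Z + k * deriv (x δ) Z * ψ Z) Y) =
      k * (ψ Y * Φ Y) + (c₀ + k * κ) * deriv ψ Y + A Y * χ Y := by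
    intro Y hY
    have h1 : ∀ δ, deriv (fun Z => E δ Z * deriv ψ Z + k * deriv (x δ) Z * ψ Z) Y =
        (1 - q δ) * deriv (x δ) Y * deriv ψ Y + E δ Y * χ Y +
          (k * deriv (deriv (x δ)) Y * ψ Y + k * deriv (x δ) Y * deriv ψ Y) := by
      intro δ
      rw [← hEx δ Y hY]
      exact (((H (hE δ) hY).fun_mul (H (D hψ) hY)).fun_add
        (((H (D (hx δ)) hY).const_mul k).fun_mul (H hψ hY))).deriv
    simp only [h1]
    rw [hΦ' Y hY, ← h₀ Y hY, ← hκ Y hY]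
    simp only [hA, Finset.mul_sum, Finset.sum_mul, ← Finset.sum_add_distrib]
    exact Finset.sum_congr rfl fun δ _ => by ring
  -- the pairings of the adjoint variation with `E` and with `x'`
  have e2 : ∀ Y ∈ I, ∑ δ, E δ Y * φ δ Y = c₀ * χ Y - deriv (fun Z => A Z * χ Z) Y := by
    intro Y hY
    have h1 : deriv (fun Z => A Z * χ Z) Y = ∑ δ, ((1 - q δ) * deriv (x δ) Y * (Q δ Y * χ Y) +
        E δ Y * deriv (fun Z => Q δ Z * χ Z) Y) := by
      have h2 : (fun Z => A Z * χ Z) = fun Z => ∑ δ, E δ Z * (Q δ Z * χ Z) := by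
        ext Z
        simp only [hA, Finset.sum_mul, mul_assoc]
      rw [h2]
      refine (HasDerivAt.fun_sum fun δ _ => ?_).deriv
      rw [← hEx δ Y hY]
      exact (H (hE δ) hY).fun_mul (H ((hQ δ).mul hχs) hY)
    rw [h1, ← h₀ Y hY, Finset.sum_mul, ← Finset.sum_sub_distrib]
    exact Finset.sum_congr rfl fun δ _ => by simp only [hφ]; ring
  have e3 : ∑ δ, deriv (x δ) X * φ δ X = Φ X * χ X - κ * deriv χ X := by
    have h1 : κ * deriv χ X = ∑ δ, (deriv (deriv (x δ)) X * (Q δ X * χ X) +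
        deriv (x δ) X * deriv (fun Z => Q δ Z * χ Z) X) := by
      have h2 : Set.EqOn (fun Z => κ * χ Z) (fun Z => ∑ δ, deriv (x δ) Z * (Q δ Z * χ Z)) I := by
        intro Z hZ
        simp only [← hκ Z hZ, Finset.sum_mul]
        exact Finset.sum_congr rfl fun δ _ => by ring
      rw [← ((H hχs hX).const_mul κ).deriv, deriv_eqOn hI h2 hX]
      exact (HasDerivAt.fun_sum fun δ _ =>
        (H (D (hx δ)) hX).fun_mul (H ((hQ δ).mul hχs) hX)).deriv
    rw [h1, hΦ' X hX, Finset.sum_mul, ← Finset.sum_sub_distrib]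
    exact Finset.sum_congr rfl fun δ _ => by simp only [hφ]; ring
  have e4 : ∑ δ, ((1 - q δ) * deriv (x δ) X * φ δ X + E δ X * deriv (φ δ) X) =
      c₀ * deriv χ X - deriv (deriv fun Z => A Z * χ Z) X := by
    have h1 : HasDerivAt (fun Y => ∑ δ, E δ Y * φ δ Y)
        (∑ δ, ((1 - q δ) * deriv (x δ) X * φ δ X + E δ X * deriv (φ δ) X)) X := by
      refine HasDerivAt.fun_sum fun δ _ => ?_
      rw [← hEx δ X hX]
      exact (H (hE δ) hX).fun_mul (H (hφs δ) hX)
    rw [← h1.deriv, deriv_eqOn hI e2 hX]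
    exact (((H hχs hX).const_mul c₀).fun_sub (H (D hAχ) hX)).deriv
  have e5 : deriv (deriv fun Y => ∑ δ, (F δ Y * (E δ Y * deriv ψ Y + k * deriv (x δ) Y * ψ Y) +
        Q δ Y * deriv (fun Z => E δ Z * deriv ψ Z + k * deriv (x δ) Z * ψ Z) Y)) X =
      k * (χ X * Φ X + 2 * deriv ψ X * deriv Φ X + ψ X * deriv (deriv Φ) X) +
        (c₀ + k * κ) * deriv χ X + deriv (deriv fun Z => A Z * χ Z) X := by
    rw [deriv_eqOn hI (deriv_eqOn hI e1) hX]
    have h1 : ∀ Y ∈ I, deriv (fun Y => k * (ψ Y * Φ Y) + (c₀ + k * κ) * deriv ψ Y + A Y * χ Y) Y =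
        k * (deriv ψ Y * Φ Y + ψ Y * deriv Φ Y) + (c₀ + k * κ) * χ Y +
          deriv (fun Z => A Z * χ Z) Y := fun Y hY =>
      (((((H hψ hY).fun_mul (H hΦ hY)).const_mul k).fun_add
        ((H (D hψ) hY).const_mul _)).fun_add (H hAχ hY)).deriv
    rw [deriv_eqOn hI h1 hX, ((((((H (D hψ) hX).fun_mul (H hΦ hX)).fun_add
      ((H hψ hX).fun_mul (H (D hΦ) hX))).const_mul k).fun_add
        ((H hχs hX).const_mul _)).fun_add (H (D hAχ) hX)).deriv]
    ring
  have e6 : ∑ δ, (E δ X * deriv (φ δ) X + ((1 - q δ) - k) * deriv (x δ) X * φ δ X) =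
      ∑ δ, ((1 - q δ) * deriv (x δ) X * φ δ X + E δ X * deriv (φ δ) X) -
        k * ∑ δ, deriv (x δ) X * φ δ X := by
    rw [Finset.mul_sum, ← Finset.sum_sub_distrib]
    exact Finset.sum_congr rfl fun δ _ => by ring
  rw [e5]
  refine (congrArg (_ + ·) (e6.trans (by rw [e4, e3]))).trans ?_
  ring

/-! ### The genus one free energy -/

section Jets

variable {m n : ℕ}

theorem pd_update {a : Jets m n → ℂ} {j : Jets m n} (ha : DifferentiableAt ℂ a j) (k : Fin m)
    (γ : Fin n) : pd γ (fun x => a (Function.update j k x)) (j k) = jpd k γ a j := by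
  have h1 : HasFDerivAt a (fderiv ℂ a j) (Function.update j k (j k)) := by
    simpa using ha.hasFDerivAt
  have h2 := h1.comp (j k) (hasFDerivAt_update (𝕜 := ℂ) j (j k))
  have h3 : HasFDerivAt (fun x => a (Function.update j k x)) _ (j k) := h2
  rw [pd, h3.fderiv, jpd, ContinuousLinearMap.comp_apply]
  congr 1
  ext i γ'
  by_cases hi : i = k
  · subst hi; simp
  · simp [hi]

theorem jetInit_mem_nhds {Ω : Set (Jets m n)} (hΩ : IsOpen Ω) {j : Jets (m + 1) n}
    (hj : jetInit j ∈ Ω) : ∀ᶠ i in 𝓝 j, jetInit i ∈ Ω :=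
  jetInit.continuous.continuousAt.eventually_mem (hΩ.mem_nhds hj)

theorem totalD_congr {a b : Jets m n → ℂ} {j : Jets (m + 1) n}
    (h : a =ᶠ[𝓝 (jetInit j)] b) : totalD a j = totalD b j := by
  rw [totalD_eq_fderiv, totalD_eq_fderiv, h.fderiv_eq]

theorem fderiv_of_line {a : Jets m n → ℂ} {j h : Jets m n} (ha : DifferentiableAt ℂ a j) {c : ℂ}
    (hc : HasDerivAt (fun s : ℂ => a (j + s • h)) c 0) : fderiv ℂ a j h = c := by
  have h1 : HasDerivAt (fun s : ℂ => j + s • h) h 0 := by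
    simpa using ((hasDerivAt_id (0 : ℂ)).smul_const h).const_add j
  have h2 : HasFDerivAt a (fderiv ℂ a j) (j + (0 : ℂ) • h) := by
    simpa using ha.hasFDerivAt
  exact (h2.comp_hasDerivAt (0 : ℂ) h1).unique hc

end Jets

namespace WDVVSolution

variable {n : ℕ} [NeZero n] {S : WDVVSolution n}

/-- A branch `(1/24) log (det M / D₀) + G` of the genus one free energy. It differs by a constant
from `(1/24) log det M + G`, and is analytic where `det M / D₀` avoids the negative real axis. -/
noncomputable def freeEnergy (S : WDVVSolution n) (G : (Fin n → ℂ) → ℂ) (D₀ : ℂ) (j : Jets 2 n) :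
    ℂ :=
  (1 / 24) * Complex.log (S.detM (j 0) (j 1) / D₀) + G (j 0)

/-- The domain of analyticity of `freeEnergy`. -/
def freeEnergyDomain (S : WDVVSolution n) (D₀ : ℂ) : Set (Jets 2 n) :=
  {j | j 0 ∈ S.U ∧ S.detM (j 0) (j 1) / D₀ ∈ Complex.slitPlane}

variable {G : (Fin n → ℂ) → ℂ} {D₀ : ℂ} {j : Jets 2 n}

theorem analyticAt_detM (hj : j 0 ∈ S.U) :
    AnalyticAt ℂ (fun j : Jets 2 n => S.detM (j 0) (j 1)) j := by
  have hp : AnalyticAt ℂ (fun j : Jets 2 n => j 0) j :=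
    (ContinuousLinearMap.proj (R := ℂ) (φ := fun _ : Fin 2 => Fin n → ℂ) 0).analyticAt j
  have hM : ∀ α β, AnalyticAt ℂ (fun j : Jets 2 n => ∑ γ, pds [α, β, γ] S.F (j 0) * j 1 γ) j :=
    fun α β => Finset.analyticAt_fun_sum _ fun γ _ =>
      (AnalyticAt.comp (g := pds [α, β, γ] S.F) (f := fun j : Jets 2 n => j 0) (x := j)
        (S.analyticAt_pds_F hj _) hp).mul
        (analyticAt_jetEntry 1 γ j)
  simp only [detM, Matrix.det_apply]
  refine Finset.analyticAt_fun_sum _ fun σ _ => ?_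
  simp only [Units.smul_def, zsmul_eq_mul]
  exact analyticAt_const.mul (Finset.analyticAt_fun_prod _ fun i _ => hM _ _)

theorem isOpen_freeEnergyDomain : IsOpen (S.freeEnergyDomain D₀) := by
  have hc : Continuous fun j : Jets 2 n => j 0 := continuous_apply 0
  have h : ContinuousOn (fun j : Jets 2 n => S.detM (j 0) (j 1) / D₀) ((fun j => j 0) ⁻¹' S.U) :=
    fun j hj => ((analyticAt_detM hj).continuousAt.div_const D₀).continuousWithinAt
  exact h.isOpen_inter_preimage (S.isOpen_U.preimage hc) Complex.isOpen_slitPlane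

theorem detM_ne_zero (hj : j ∈ S.freeEnergyDomain D₀) : S.detM (j 0) (j 1) ≠ 0 ∧ D₀ ≠ 0 := by
  have h := Complex.slitPlane_ne_zero hj.2
  exact div_ne_zero_iff.mp h

section

variable (hG : AnalyticOnNhd ℂ G S.U) (hj : j ∈ S.freeEnergyDomain D₀)
include hG hj

theorem analyticAt_freeEnergy : AnalyticAt ℂ (S.freeEnergy G D₀) j := by
  have hp : AnalyticAt ℂ (fun j : Jets 2 n => j 0) j :=
    (ContinuousLinearMap.proj (R := ℂ) (φ := fun _ : Fin 2 => Fin n → ℂ) 0).analyticAt j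
  have h1 : AnalyticAt ℂ (fun j : Jets 2 n => S.detM (j 0) (j 1) / D₀) j := by
    simp only [div_eq_mul_inv]
    exact (analyticAt_detM hj.1).mul analyticAt_const
  exact (analyticAt_const.mul (h1.clog hj.2)).add
    (AnalyticAt.comp (g := G) (hG _ hj.1) hp)

/-- The differential of the free energy does not depend on the branch. -/
theorem fderiv_freeEnergy (h : Jets 2 n) : fderiv ℂ (S.freeEnergy G D₀) j h =
    (1 / 24) * (fderiv ℂ (fun j : Jets 2 n => S.detM (j 0) (j 1)) j h / S.detM (j 0) (j 1)) +
      ∑ γ, h 0 γ * pd γ G (j 0) := by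
  obtain ⟨hM, hD⟩ := detM_ne_zero hj
  have h1 := (analyticAt_detM hj.1).differentiableAt.hasFDerivAt
  have h2 : HasFDerivAt (fun j : Jets 2 n => S.detM (j 0) (j 1) / D₀)
      (D₀⁻¹ • fderiv ℂ (fun j : Jets 2 n => S.detM (j 0) (j 1)) j) j := by
    simp only [div_eq_mul_inv]
    exact h1.mul_const D₀⁻¹
  have h3 := (h2.clog hj.2).const_mul (1 / 24)
  have hp : HasFDerivAt (fun j : Jets 2 n => j 0)
      (ContinuousLinearMap.proj (R := ℂ) (φ := fun _ : Fin 2 => Fin n → ℂ) 0) j :=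
    (ContinuousLinearMap.proj (R := ℂ) (φ := fun _ : Fin 2 => Fin n → ℂ) 0).hasFDerivAt
  have h4 : HasFDerivAt (fun j : Jets 2 n => G (j 0)) _ j :=
    HasFDerivAt.comp (g := G) j (hG _ hj.1).differentiableAt.hasFDerivAt hp
  have h5 : HasFDerivAt (S.freeEnergy G D₀) _ j := h3.fun_add h4
  rw [h5.fderiv, ← fderiv_eq_sum_pd]
  simp only [add_apply, smul_apply, smul_eq_mul,
    ContinuousLinearMap.comp_apply, ContinuousLinearMap.proj_apply]
  field_simp

theorem dF1_dt_eq_jpd (γ : Fin n) :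
    S.dF1_dt G γ (j 0) (j 1) = jpd 0 γ (S.freeEnergy G D₀) j := by
  have h1 := pd_update (analyticAt_detM hj.1).differentiableAt 0 γ
  simp only [Function.update_self, ne_eq, one_ne_zero, not_false_eq_true,
    Function.update_of_ne] at h1
  rw [jpd, fderiv_freeEnergy hG hj, dF1_dt, h1, jpd]
  simp [Pi.single_apply]

theorem dF1_dtX_eq_jpd (γ : Fin n) :
    S.dF1_dtX γ (j 0) (j 1) = jpd 1 γ (S.freeEnergy G D₀) j := by
  have h1 := pd_update (analyticAt_detM hj.1).differentiableAt 1 γ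
  simp only [Function.update_self, ne_eq, zero_ne_one, not_false_eq_true,
    Function.update_of_ne] at h1
  rw [jpd, fderiv_freeEnergy hG hj, dF1_dtX, h1, jpd]
  simp

end

theorem fderiv_detM_of_line (hj : j 0 ∈ S.U) {h : Jets 2 n} {c : ℂ}
    (hc : HasDerivAt (fun s : ℂ => S.detM (j 0 + s • h 0) (j 1 + s • h 1)) c 0) :
    fderiv ℂ (fun j : Jets 2 n => S.detM (j 0) (j 1)) j h = c :=
  fderiv_of_line (analyticAt_detM hj).differentiableAt hc

/-- The free energy is homogeneous of degree zero in `t_X`, up to the constant `n / 24`. -/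
theorem sum_jpd_one_freeEnergy (hG : AnalyticOnNhd ℂ G S.U) (hj : j ∈ S.freeEnergyDomain D₀) :
    ∑ γ, jpd 1 γ (S.freeEnergy G D₀) j * j 1 γ = n / 24 := by
  have h1 := fderiv_eq_sum_jpd (S.freeEnergy G D₀) j ![0, j 1]
  simp only [Fin.sum_univ_two, Matrix.cons_val_zero, Matrix.cons_val_one, Pi.zero_apply, mul_zero,
    Finset.sum_const_zero, zero_add] at h1
  rw [← h1, fderiv_freeEnergy hG hj, fderiv_detM_of_line (c := n * S.detM (j 0) (j 1)) hj.1]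
  · have := (detM_ne_zero hj).1
    simp only [Matrix.cons_val_zero, Pi.zero_apply, zero_mul, Finset.sum_const_zero, add_zero]
    field_simp
  · have h2 := hasDerivAt_det (𝕜 := ℂ) (s := 0) (p := fun _ : Fin n => 1) (q := fun _ => 0)
      (M := fun s => Matrix.of fun α β =>
        ∑ γ, pds [α, β, γ] S.F (j 0) * (j 1 + s • j 1) γ) ?_
    · simpa [detM] using h2
    · intro α β
      simp only [Matrix.of_apply, zero_smul, add_zero, one_mul]
      refine HasDerivAt.fun_sum fun γ _ => ?_
      have h3 : HasDerivAt (fun s : ℂ => (j 1 + s • j 1) γ) (j 1 γ) 0 := by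
        simpa using ((hasDerivAt_id (0 : ℂ)).mul_const (j 1 γ)).const_add (j 1 γ)
      exact h3.const_mul _

/-- The free energy is quasihomogeneous: its derivative along the Euler vector field, prolonged to
`t_X`, is the constant `n / 24 + E(G)`. -/
theorem euler_freeEnergy (hη : ∀ α β : Fin n, S.η α β = if β = Fin.rev α then 1 else 0)
    (hG : AnalyticOnNhd ℂ G S.U) (hj : j ∈ S.freeEnergyDomain D₀) :
    ∑ γ, (jpd 0 γ (S.freeEnergy G D₀) j * S.E γ (j 0) +
      jpd 1 γ (S.freeEnergy G D₀) j * ((1 - S.q γ) * j 1 γ)) =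
      n / 24 + ∑ ε, S.E ε (j 0) * pd ε G (j 0) := by
  have h1 := fderiv_eq_sum_jpd (S.freeEnergy G D₀) j
    ![fun γ => S.E γ (j 0), fun γ => (1 - S.q γ) * j 1 γ]
  simp only [Fin.sum_univ_two, Matrix.cons_val_zero, Matrix.cons_val_one] at h1
  rw [Finset.sum_add_distrib, ← h1, fderiv_freeEnergy hG hj,
    fderiv_detM_of_line (c := n * S.detM (j 0) (j 1)) hj.1]
  · have := (detM_ne_zero hj).1
    simp only [Matrix.cons_val_zero]
    field_simp
  · have h2 := hasDerivAt_det (𝕜 := ℂ) (s := 0) (p := fun α : Fin n => S.q α + (1 - S.d))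
      (q := S.q) (M := fun s => Matrix.of fun α β => ∑ γ,
        pds [α, β, γ] S.F (j 0 + s • fun γ => S.E γ (j 0)) *
          (j 1 + s • fun γ => (1 - S.q γ) * j 1 γ) γ) ?_
    · have h3 : ∑ α, (S.q α + (1 - S.d)) + ∑ α, S.q α = n := by
        rw [Finset.sum_add_distrib, sum_q hη hj.1]
        simp
        ring
      rw [h3] at h2
      simpa [detM] using h2
    · intro α β
      simp only [Matrix.of_apply, zero_smul, add_zero, Finset.mul_sum]
      refine HasDerivAt.fun_sum fun γ _ => ?_
      have h3 : HasDerivAt (fun s : ℂ => (j 1 + s • fun γ => (1 - S.q γ) * j 1 γ) γ)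
          ((1 - S.q γ) * j 1 γ) 0 := by
        simpa using ((hasDerivAt_id (0 : ℂ)).mul_const ((1 - S.q γ) * j 1 γ)).const_add (j 1 γ)
      have h4 := (hasDerivAt_line (S.analyticAt_pds_F hj.1 [α, β, γ])
        fun γ => S.E γ (j 0)).fun_mul h3
      rw [S.euler_pds_three hj.1] at h4
      convert! h4 using 1
      simp only [zero_smul, add_zero]
      ring

/-! ### The infinitesimal transformation of the last coordinate -/

section

variable (hη : ∀ α β : Fin n, S.η α β = if β = Fin.rev α then 1 else 0)
include hη

/-- The flow `∂/∂T^{1,0}` is the translation `∂/∂X`. -/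
theorem flow_zero (γ : Fin n) (hj : j 0 ∈ S.U) : S.flow 0 γ j = j 1 γ := by
  simp [flow, c1_zero hη hj]

theorem totalD_flow_zero (γ : Fin n) {j : Jets 3 n} (hj : j 0 ∈ S.U) :
    totalD (S.flow 0 γ) j = j 2 γ := by
  have hc : Continuous fun j : Jets 2 n => j 0 := continuous_apply 0
  have hmem : jetInit j ∈ (fun j : Jets 2 n => j 0) ⁻¹' S.U := hj
  have h1 : S.flow 0 γ =ᶠ[𝓝 (jetInit j)] fun j => j 1 γ := by
    filter_upwards [(S.isOpen_U.preimage hc).mem_nhds hmem] with i hi using flow_zero hη γ hi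
  have h2 : HasFDerivAt (fun j : Jets 2 n => j 1 γ)
      ((ContinuousLinearMap.proj (R := ℂ) (φ := fun _ : Fin n => ℂ) γ).comp
        (ContinuousLinearMap.proj (R := ℂ) (φ := fun _ : Fin 2 => Fin n → ℂ) 1)) (jetInit j) :=
    ((ContinuousLinearMap.proj (R := ℂ) (φ := fun _ : Fin n => ℂ) γ).comp
      (ContinuousLinearMap.proj (R := ℂ) (φ := fun _ : Fin 2 => Fin n → ℂ) 1)).hasFDerivAt
  rw [totalD_congr h1, totalD_eq_fderiv, h2.fderiv]
  rfl

variable (hG : AnalyticOnNhd ℂ G S.U)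
include hG

theorem dF1_dT_zero {j : Jets 3 n} (hj : jetInit j ∈ S.freeEnergyDomain D₀) :
    S.dF1_dT G 0 j = totalD (S.freeEnergy G D₀) j := by
  have h0 : j 0 ∈ S.U := hj.1
  simp only [dF1_dT, totalD_flow_zero hη _ h0]
  rw [totalD, Fin.sum_univ_two, ← Finset.sum_add_distrib]
  refine Finset.sum_congr rfl fun γ _ => ?_
  have h1 := dF1_dt_eq_jpd hG hj γ
  have h2 := dF1_dtX_eq_jpd hG hj γ
  have h3 : S.flow 0 γ (fun i => j i.castSucc) = j 1 γ := flow_zero hη γ hj.1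
  rw [h3]
  exact congrArg₂ (· + ·) (congrArg (· * _) h1) (congrArg (· * _) h2)

theorem wLow_zero_eventuallyEq {j : Jets 4 n} (hj : jetInit (jetInit j) ∈ S.freeEnergyDomain D₀) :
    S.wLow G 0 =ᶠ[𝓝 j] totalD (totalD (S.freeEnergy G D₀)) := by
  have hΩ : IsOpen (jetInit ⁻¹' S.freeEnergyDomain D₀ : Set (Jets 3 n)) :=
    isOpen_freeEnergyDomain.preimage jetInit.continuous
  filter_upwards [jetInit_mem_nhds hΩ hj] with i hi
  refine totalD_congr ?_
  filter_upwards [jetInit_mem_nhds isOpen_freeEnergyDomain hi] with l hl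
  exact dF1_dT_zero hη hG hl

omit hG in
theorem backlund_last (ε : ℂ) :
    S.backlund G ε S.last = fun j => j 0 S.last + ε ^ 2 * S.wLow G 0 j := by
  ext j
  simp [backlund, wUp, η_inv_last hη]

end

end WDVVSolution
end OneLoop

namespace OneLoop

namespace WDVVSolution

variable {n : ℕ} [NeZero n] {S : WDVVSolution n} {G : (Fin n → ℂ) → ℂ}

section

variable {v : ℝ → Fin n → ℂ} (hv : ContDiff ℝ ∞ v) (hvU : ∀ X, v X ∈ S.U)
include hv hvU

theorem isLocalLinear_bracket0 {I : Set ℝ} (hI : IsOpen I)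
    (hη : ∀ α β : Fin n, S.η α β = if β = Fin.rev α then 1 else 0) (γ δ : Fin n) :
    IsLocalLinear I (S.bracket0 v γ δ) := by
  have hvs : ∀ γ, ContDiffOn ℝ ∞ (fun Y => v Y γ) I := fun γ => (contDiff_pi.mp hv γ).contDiffOn
  have hF : ∀ l, ContDiffOn ℝ ∞ (fun Y => pds l S.F (v Y)) I := fun l X _ =>
    (ContDiffAt.comp X (((S.analyticAt_pds_F (hvU X) l).contDiffAt).restrict_scalars ℝ)
      hv.contDiffAt).contDiffWithinAt
  have ha : ContDiffOn ℝ ∞ (fun Y => S.g γ δ (v Y)) I := by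
    simp only [g, c2_eq hη, E]
    exact ContDiffOn.sum fun ε _ =>
      ((contDiffOn_const.mul (hvs ε)).add contDiffOn_const).mul (hF _)
  have hb : ContDiffOn ℝ ∞ (fun Y => ∑ ε, S.Γ γ δ ε (v Y) * jet 2 v Y 1 ε) I := by
    simp only [Γ, c2_eq hη]
    exact ContDiffOn.sum fun ε _ => (contDiffOn_const.mul (hF _)).mul
      (contDiffOn_pi.mp (contDiffOn_pi.mp (contDiffOn_jet hI hvs) 1) ε)
  convert! isLocalLinear_firstOrder hI ha hb using 1
  ext ψ X
  simp [bracket0, mulX, delta]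

/-- The first order term of the transformed bracket: it is the Virasoro bracket for the first order
correction `w` of `t^n`, with the central term of the deformed bracket. -/
theorem transformed_firstOrder (hη : ∀ α β : Fin n, S.η α β = if β = Fin.rev α then 1 else 0)
    (hss : S.IsSemisimple) (hG : S.IsGFunction G) {I : Set ℝ} (hI : IsOpen I) {D₀ : ℂ}
    (hD : ∀ Y ∈ I, jet 2 v Y ∈ S.freeEnergyDomain D₀) {ψ : ℝ → ℂ} (hψ : ContDiff ℝ ∞ ψ) {X : ℝ}
    (hX : X ∈ I) :
    fderiv ℂ (S.wLow G 0) (jet 4 v X) (jet 4 (fun Y γ => S.bracket0 v γ S.last ψ Y) X) +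
        ∑ δ, S.bracket0 v S.last δ (adjointVariation (S.wLow G 0) v δ ψ) X =
      (1 - S.d) / 2 * (2 * S.wLow G 0 (jet 4 v X) * deriv ψ X +
        deriv (fun Y => S.wLow G 0 (jet 4 v Y)) X * ψ X) +
      ((n : ℂ) / 8 - 1 / 2 * ∑ α, S.μ α ^ 2) * iteratedDeriv 3 ψ X := by
  set f := S.freeEnergy G D₀ with hf
  have hvs : ∀ γ, ContDiffOn ℝ ∞ (fun Y => v Y γ) I := fun γ => (contDiff_pi.mp hv γ).contDiffOn
  have hψs : ContDiffOn ℝ ∞ ψ I := hψ.contDiffOn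
  have hfa : ∀ Y ∈ I, AnalyticAt ℂ f (jet 2 v Y) := fun Y hY =>
    analyticAt_freeEnergy hG.analytic (hD Y hY)
  have hf1a : ∀ Y ∈ I, AnalyticAt ℂ (totalD f) (jet 3 v Y) := fun Y hY =>
    analyticAt_totalD (hfa Y hY)
  have hweq : ∀ Y ∈ I, S.wLow G 0 =ᶠ[𝓝 (jet 4 v Y)] totalD (totalD f) := fun Y hY =>
    wLow_zero_eventuallyEq hη hG.analytic (hD Y hY)
  -- the total derivatives of the free energy along the curve
  set Φ : ℝ → ℂ := fun Y => totalD f (jet 3 v Y) with hΦ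
  have hΦs : ContDiffOn ℝ ∞ Φ I := contDiffOn_comp_jet hI hvs hf1a
  have hW : Set.EqOn (fun Y => S.wLow G 0 (jet 4 v Y)) (deriv Φ) I := fun Y hY =>
    (hweq Y hY).self_of_nhds.trans (totalD_jet hI hvs hY (hf1a Y hY))
  set E : Fin n → ℝ → ℂ := fun δ Y => S.E δ (v Y) with hE
  have hEs : ∀ δ, ContDiffOn ℝ ∞ (E δ) I := fun δ =>
    (contDiffOn_const.mul (hvs δ)).add contDiffOn_const
  have hEx : ∀ δ, ∀ Y ∈ I, deriv (E δ) Y = (1 - S.q δ) * deriv (fun Y => v Y δ) Y := by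
    intro δ Y hY
    exact (((differentiableAt_of_smoothOn hI (hvs δ) hY).hasDerivAt.const_mul _).add_const _).deriv
  -- the variation of `w` along the Hamiltonian vector field of `v^n`
  have hξ : ∀ γ, S.bracket0 v γ S.last ψ = fun Y => E γ Y * deriv ψ Y +
      (1 - S.d) / 2 * deriv (fun Y => v Y γ) Y * ψ Y := fun γ =>
    funext fun Y => bracket0_last_right hη v hvU γ ψ Y
  have hξs : ∀ γ, ContDiffOn ℝ ∞ (S.bracket0 v γ S.last ψ) I := fun γ =>
    (isLocalLinear_bracket0 hv hvU hI hη γ S.last).smooth _ hψs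
  have h1 : fderiv ℂ (S.wLow G 0) (jet 4 v X) (jet 4 (fun Y γ => S.bracket0 v γ S.last ψ Y) X) =
      deriv (deriv fun Y => ∑ γ, (jpd 0 γ f (jet 2 v Y) * S.bracket0 v γ S.last ψ Y +
        jpd 1 γ f (jet 2 v Y) * deriv (S.bracket0 v γ S.last ψ) Y)) X := by
    rw [(hweq X hX).fderiv_eq, fderiv_totalD_jet hI hvs hξs hX (hf1a X hX)]
    have h2 : ∀ Y ∈ I, fderiv ℂ (totalD f) (jet 3 v Y)
        (jet 3 (fun Y γ => S.bracket0 v γ S.last ψ Y) Y) =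
        deriv (fun Y => ∑ γ, (jpd 0 γ f (jet 2 v Y) * S.bracket0 v γ S.last ψ Y +
          jpd 1 γ f (jet 2 v Y) * deriv (S.bracket0 v γ S.last ψ) Y)) Y := by
      intro Y hY
      rw [fderiv_totalD_jet hI hvs hξs hY (hfa Y hY)]
      congr 1
      ext Z
      rw [fderiv_eq_sum_jpd, Fin.sum_univ_two, ← Finset.sum_add_distrib]
      simp [jet]
    exact deriv_eqOn hI h2 hX
  -- the adjoint variation of `w`
  have h3 : ∀ δ, Set.EqOn (adjointVariation (S.wLow G 0) v δ ψ)
      (fun Y => jpd 0 δ f (jet 2 v Y) * deriv (deriv ψ) Y -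
        deriv (fun Z => jpd 1 δ f (jet 2 v Z) * deriv (deriv ψ) Z) Y) I := by
    intro δ Y hY
    have e1 : adjointVariation (S.wLow G 0) v δ ψ Y =
        adjointVariation (totalD (totalD f)) v δ ψ Y := by
      refine Finset.sum_congr rfl fun l _ => ?_
      refine ((isLocalLinear_negDeriv hI).iterate l).congr _ _ (fun Z hZ => ?_) hY
      simp only [jpd, (hweq Z hZ).fderiv_eq]
    have hN := (isLocalLinear_negDeriv hI).smooth _ hψs
    rw [e1, adjointVariation_totalD hI hvs hf1a δ hψs hY,
      adjointVariation_totalD hI hvs hfa δ hN hY]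
    have e2 : negDeriv (negDeriv ψ) = deriv (deriv ψ) := by
      ext Z
      have : negDeriv ψ = -deriv ψ := rfl
      simp [negDeriv, this, deriv.neg]
    rw [e2, adjointVariation, Fin.sum_univ_two]
    rfl
  have h4 : ∀ δ, S.bracket0 v S.last δ (adjointVariation (S.wLow G 0) v δ ψ) X =
      E δ X * deriv (fun Y => jpd 0 δ f (jet 2 v Y) * deriv (deriv ψ) Y -
          deriv (fun Z => jpd 1 δ f (jet 2 v Z) * deriv (deriv ψ) Z) Y) X +
        ((1 - S.q δ) - (1 - S.d) / 2) * deriv (fun Y => v Y δ) X *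
          (jpd 0 δ f (jet 2 v X) * deriv (deriv ψ) X -
            deriv (fun Z => jpd 1 δ f (jet 2 v Z) * deriv (deriv ψ) Z) X) := by
    intro δ
    rw [(isLocalLinear_bracket0 hv hvU hI hη S.last δ).congr _ _ (h3 δ) hX,
      bracket0_last hη v hvU]
    simp only [hE]
    ring
  have hjet0 : ∀ Y, jet 2 v Y 0 = v Y := fun Y => by
    ext γ
    simp [jet]
  have hjet1 : ∀ Y γ, jet 2 v Y 1 γ = deriv (fun Y => v Y γ) Y := fun Y γ => by
    simp [jet]
  have h5 := variation_add_adjoint hI (x := fun γ Y => v Y γ) (E := E)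
    (F := fun γ Y => jpd 0 γ f (jet 2 v Y)) (Q := fun γ Y => jpd 1 γ f (jet 2 v Y)) (Φ := Φ)
    (ψ := ψ) (q := S.q) (c₀ := n / 24 + (n * S.d / 48 - (1 / 4) * ∑ α, S.μ α ^ 2)) (κ := n / 24)
    (k := (1 - S.d) / 2) hvs hEs (fun γ => contDiffOn_jpd_jet hI hvs hfa 0 γ)
    (fun γ => contDiffOn_jpd_jet hI hvs hfa 1 γ) hΦs hψs hEx
    (fun Y hY => by
      rw [← euler_G hη hss hG (hvU Y), ← hjet0 Y, ← euler_freeEnergy hη hG.analytic (hD Y hY)]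
      simp only [hE, hjet0, hjet1, hf])
    (fun Y hY => by
      rw [← sum_jpd_one_freeEnergy hG.analytic (hD Y hY)]
      simp only [hjet1, hf])
    (fun Y hY => by
      simp only [hΦ, totalD, Fin.sum_univ_two, ← Finset.sum_add_distrib]
      refine Finset.sum_congr rfl fun γ _ => ?_
      have e0 : jet 3 v Y (Fin.succ 0) γ = deriv (fun Y => v Y γ) Y := by simp [jet]
      have e1 : jet 3 v Y (Fin.succ 1) γ = deriv (deriv fun Y => v Y γ) Y := by
        simp [jet, iteratedDeriv_succ]
      rw [e0, e1]
      rfl)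
    hX
  rw [h1]
  simp only [hξ, h4]
  have hWX : S.wLow G 0 (jet 4 v X) = deriv Φ X := hW hX
  rw [h5, hWX, deriv_eqOn hI hW hX]
  simp only [iteratedDeriv_succ, iteratedDeriv_zero]
  ring

/-- The transformed bracket of `T` and the Virasoro bracket differ by a multiple of `ε⁴`. -/
theorem virasoro_transformedBracket
    (hη : ∀ α β : Fin n, S.η α β = if β = Fin.rev α then 1 else 0) (hd : S.d ≠ 1)
    (hss : S.IsSemisimple) (hG : S.IsGFunction G)
    (hdet : ∀ X, S.detM (jet 2 v X 0) (jet 2 v X 1) ≠ 0) {ψ : ℝ → ℂ} (hψ : ContDiff ℝ ∞ ψ)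
    (X : ℝ) (ε : ℂ) :
    ((2 / (1 - S.d)) ^ 2 • S.transformedBracket G ε v S.last S.last) ψ X -
        virasoro (fun Y => 2 / (1 - S.d) * S.backlund G ε S.last (jet 4 v Y))
          S.centralCharge ε ψ X =
      (2 / (1 - S.d)) ^ 2 * bracketOf (S.bracket0 v) v (S.wLow G 0) (S.wLow G 0) ψ X * ε ^ 4 := by
  have hd' : 1 - S.d ≠ 0 := sub_ne_zero.mpr hd.symm
  have hjet0 : ∀ Y, jet 2 v Y 0 = v Y := fun Y => by
    ext γ
    simp [jet]
  -- a neighbourhood of `X` on which one branch of `log det M` is defined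
  set D₀ := S.detM (jet 2 v X 0) (jet 2 v X 1) with hD₀
  have hcont : Continuous fun Y => S.detM (jet 2 v Y 0) (jet 2 v Y 1) / D₀ := by
    have h := contDiffOn_comp_jet isOpen_univ (fun γ => (contDiff_pi.mp hv γ).contDiffOn)
      (fun Y _ => analyticAt_detM (S := S) (j := jet 2 v Y) (by rw [hjet0]; exact hvU Y))
    exact (contDiffOn_univ.mp h).continuous.div_const D₀
  set I : Set ℝ := (fun Y => S.detM (jet 2 v Y 0) (jet 2 v Y 1) / D₀) ⁻¹' Complex.slitPlane
    with hIdef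
  have hI : IsOpen I := Complex.isOpen_slitPlane.preimage hcont
  have hX : X ∈ I := by
    have h : D₀ / D₀ = 1 := div_self (hdet X)
    simp only [hIdef, Set.mem_preimage, ← hD₀, h]
    exact Complex.one_mem_slitPlane
  have hD : ∀ Y ∈ I, jet 2 v Y ∈ S.freeEnergyDomain D₀ := fun Y hY =>
    ⟨by rw [hjet0]; exact hvU Y, hY⟩
  have hvs : ∀ γ, ContDiffOn ℝ ∞ (fun Y => v Y γ) I := fun γ => (contDiff_pi.mp hv γ).contDiffOn
  have hwa : ∀ Y ∈ I, AnalyticAt ℂ (S.wLow G 0) (jet 4 v Y) := fun Y hY =>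
    (analyticAt_totalD (analyticAt_totalD
      (analyticAt_freeEnergy hG.analytic (hD Y hY)))).congr
        (wLow_zero_eventuallyEq hη hG.analytic (hD Y hY)).symm
  have hws : ContDiffOn ℝ ∞ (fun Y => S.wLow G 0 (jet 4 v Y)) I := contDiffOn_comp_jet hI hvs hwa
  have h1 := bracketOf_deformed hI hvs (isLocalLinear_bracket0 hv hvU hI hη) hwa S.last (ε ^ 2)
    hψ.contDiffOn hX
  rw [transformed_firstOrder hv hvU hη hss hG hI hD hψ hX, bracket0_last hη v hvU] at h1
  have hψ1 : DifferentiableAt ℝ ψ X := hψ.differentiable (by simp) X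
  have hv1 := (differentiableAt_of_smoothOn hI (hvs S.last) hX).hasDerivAt
  have hw1 := (differentiableAt_of_smoothOn hI hws hX).hasDerivAt
  have hjet4 : ∀ Y, jet 4 v Y 0 S.last = v Y S.last := fun Y => by simp [jet]
  have hL := (((hv1.fun_add (hw1.const_mul (ε ^ 2))).const_mul (2 / (1 - S.d))).fun_mul
    hψ1.hasDerivAt).deriv
  simp only [Pi.smul_apply, smul_eq_mul, transformedBracket, backlund_last hη, h1, virasoro,
    mulX, mulY, delta, Pi.add_apply, iteratedDeriv_one, hjet4, hL, E, r_last hη hd (hvU X),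
    q_last hη (hvU X), centralCharge]
  field_simp
  ring

end

end WDVVSolution

end OneLoop

theorem corollary1 {n : ℕ} [NeZero n] (S : OneLoop.WDVVSolution n)
    (hη : ∀ α β : Fin n, S.η α β = if β = Fin.rev α then 1 else 0)
    (hd : S.d ≠ 1) (hss : S.IsSemisimple)
    (G : (Fin n → ℂ) → ℂ) (hG : S.IsGFunction G) :
    -- the bracket in the coordinates `t`, for `T(X) = 2 t^n(X) / (1 - d)`
    (∀ (ε : ℂ) (t : ℝ → Fin n → ℂ), ContDiff ℝ ∞ t → (∀ X, t X ∈ S.U) →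
      OneLoop.LocalKernel.DistribEq
        ((2 / (1 - S.d)) ^ 2 • S.bracket2 G ε t S.last S.last)
        (OneLoop.LocalKernel.virasoro (fun X => 2 / (1 - S.d) * t X S.last)
          S.centralCharge ε)) ∧
    -- the bracket as the image of the genus zero bracket under `t = v + ε² w`, modulo `O(ε⁴)`
    (∀ v : ℝ → Fin n → ℂ, ContDiff ℝ ∞ v → (∀ X, v X ∈ S.U) →
      (∀ X, S.detM (OneLoop.jet 2 v X 0) (OneLoop.jet 2 v X 1) ≠ 0) →
      ∀ ψ : ℝ → ℂ, ContDiff ℝ ∞ ψ → ∀ X : ℝ,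
        (fun ε : ℂ =>
          ((2 / (1 - S.d)) ^ 2 • S.transformedBracket G ε v S.last S.last) ψ X -
            OneLoop.LocalKernel.virasoro
              (fun Y => 2 / (1 - S.d) * S.backlund G ε S.last (OneLoop.jet 4 v Y))
              S.centralCharge ε ψ X) =O[𝓝 0] (fun ε : ℂ => ε ^ 4)) := by
  refine ⟨fun ε t ht htU => OneLoop.WDVVSolution.virasoro_bracket2 hη hd hss hG ε t htU ht, ?_⟩
  intro v hv hvU hdet ψ hψ X
  simp only [OneLoop.WDVVSolution.virasoro_transformedBracket hv hvU hη hd hss hG hdet hψ X]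
  exact Asymptotics.isBigO_const_mul_self _ _ _
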